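/- Let $M$ be a compact smooth manifold without boundary, $T>0$, $I=[0,T]$, and let $g(t)$, $t\in I$, be a smooth Ricci flow on $M$, $\partial g/\partial t=-2\,\mathrm{Ric}_{g(t)}$. Let $\hat g=g(t)+dt^2$ be the metric on $M\times I$ that is the orthogonal sum of the $g(t)$ and the standard metric of $I$, and let $\nabla$ be its Levi-Civita connection. A curve-shrinking flow is a smooth map $c\colon S^1\times I\to M$ such that every $c(\cdot,t)$ is an immersion and $\partial c/\partial t=H$, where $X=c_*(\partial_x)$ is the velocity in the angular coordinate $x$, $S=X/|X|_{g(t)}$ is the unit tangent vector and $H=\nabla^{g(t)}_SS$ is the curvature vector of $c(\cdot,t)$ with respect to $g(t)$. Write $k=|H|_{g(t)}$ for its curvature, $f'=|X|^{-1}\partial f/\partial x$ for the derivative with respect to arc length, and, for $\epsilon>0$, $h=h_\epsilon=\sqrt{k^2+\epsilon^2}$. Let $\perp$ denote the component orthogonal to $S$ with respect to $\hat g$, and $\langle\cdot,\cdot\rangle=\hat g$. There is a constant $\widehat C$, $0\le\widehat C<\infty$, depending only on the Ricci flow $(M,g(t))_{t\in I}$, such that for every curve-shrinking flow $c\colon S^1\times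 I\to M$ the following hold. 1. $k^2$ is smooth on $S^1\times I$, and everywhere on $S^1\times I$ $$\frac{\partial}{\partial t}k^2\le (k^2)''-2\langle(\nabla_SH)^\perp,(\nabla_SH)^\perp\rangle+2k^4+\widehat C(k^2+k).$$ 2. For every $\epsilon>0$, $h=h_\epsilon$ is smooth on $S^1\times I$, and everywhere on $S^1\times I$ $$\frac{\partial h}{\partial t}\le h''+k^3+C_1(h+1),\qquad C_1=\widehat C/2 .$$ (Time derivatives at $t=0$ and $t=T$ are one-sided.) -/

import Mathlib

open Set Manifold Bundle
open scoped ContDiff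

noncomputable section

/-! ### Riemannian geometry in an open (or relatively open) set of coordinates -/

section Coordinates

variable {F : Type*} [NormedAddCommGroup F] [NormedSpace ℝ F]

/-- The Christoffel symbols of the metric `G`, given on the coordinate domain `s`, contracted with
the vectors `u, v`: the unique vector `Γ(u,v)` with
`G(Γ(u,v),w) = (1/2) (∂_u G(v,w) + ∂_v G(u,w) - ∂_w G(u,v))` for all `w`
(the inverse of `G y : F → F*` raises the index). Its coordinates are `Γ^k_{ij} u^i v^j`. -/
def christoffel (s : Set F) (G : F → F →L[ℝ] F →L[ℝ] ℝ) (y u v : F) : F :=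
  (G y).inverse ((1 / 2 : ℝ) •
    (fderivWithin ℝ G s y u v + fderivWithin ℝ G s y v u
      - ((fderivWithin ℝ G s y).flip u).flip v))

/-- The Riemann curvature operator `R(u,v)w = ∇_u ∇_v w - ∇_v ∇_u w` evaluated on
constant coordinate vector fields. -/
def curvatureOperator (s : Set F) (G : F → F →L[ℝ] F →L[ℝ] ℝ) (y u v w : F) : F :=
  fderivWithin ℝ (fun z => christoffel s G z v w) s y u
    - fderivWithin ℝ (fun z => christoffel s G z u w) s y v
    + christoffel s G y u (christoffel s G y v w)
    - christoffel s G y v (christoffel s G y u w)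

/-- The Ricci curvature `Ric(v,w)`, the trace of `u ↦ R(u,v)w`. -/
def ricciCurvature [FiniteDimensional ℝ F] (s : Set F) (G : F → F →L[ℝ] F →L[ℝ] ℝ)
    (y v w : F) : ℝ :=
  ∑ i, (Module.finBasis ℝ F).coord i (curvatureOperator s G y (Module.finBasis ℝ F i) v w)

/-- The Levi-Civita covariant derivative of the vector field `V` along the curve `γ`,
in the direction of the velocity of `γ`: `V' + Γ(γ', V)`. -/
def covDerivAlong (s : Set F) (G : F → F →L[ℝ] F →L[ℝ] ℝ) (γ V : ℝ → F) (x : ℝ) : F :=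
  deriv V x + christoffel s G (γ x) (deriv γ x) (V x)

end Coordinates

section Flow

variable {E : Type*} [NormedAddCommGroup E] [NormedSpace ℝ E] [FiniteDimensional ℝ E]
  {M : Type*} [TopologicalSpace M] [ChartedSpace E M] [IsManifold 𝓘(ℝ, E) ∞ M]

variable (E M) in
/-- Smooth Riemannian metrics on the manifold `M` (without boundary, modelled on `E`). -/
abbrev SmoothMetric :=
  ContMDiffRiemannianMetric 𝓘(ℝ, E) ∞ E (fun x : M => TangentSpace 𝓘(ℝ, E) x)

variable (E) in
/-- The domain in `E` of the coordinates given by the chart around `p`. -/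
def chartDomain (p : M) : Set E := (extChartAt 𝓘(ℝ, E) p).target

/-- The metric `g` in the coordinates given by the chart around `p`
(the pullback of `g` by the inverse chart; each tangent space is `E` by definition). -/
def coordMetric (g : SmoothMetric E M) (p : M) (y : E) : E →L[ℝ] E →L[ℝ] ℝ :=
  let A : E →L[ℝ] E := mfderiv 𝓘(ℝ, E) 𝓘(ℝ, E) (extChartAt 𝓘(ℝ, E) p).symm y
  let B : E →L[ℝ] E →L[ℝ] ℝ := g.inner ((extChartAt 𝓘(ℝ, E) p).symm y)
  B.bilinearComp A A

/-- `g(t)`, `t ∈ [0,T]`, is a (smooth) Ricci flow on `M`: in all charts the metric coefficients are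
smooth in space and time, and `∂g/∂t = -2 Ric(g(t))`. Values of `g` outside `[0,T]` are irrelevant;
time derivatives at the end points are one-sided. -/
structure IsRicciFlow (T : ℝ) (g : ℝ → SmoothMetric E M) : Prop where
  smooth : ∀ p : M, ContDiffOn ℝ ∞ (fun q : E × ℝ => coordMetric (g q.2) p q.1)
    (chartDomain E p ×ˢ Icc 0 T)
  flow : ∀ p : M, ∀ y ∈ chartDomain E p, ∀ t ∈ Icc 0 T, ∀ u v : E,
    HasDerivWithinAt (fun τ => coordMetric (g τ) p y u v)
      (-2 * ricciCurvature (chartDomain E p) (coordMetric (g t) p) y u v) (Icc 0 T) t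

/-- The metric `ĝ = g(t) + dt²` on `M × [0,T]`, in the coordinates given by the chart
around `p` and the identity of `[0,T]`. -/
def coordSpacetimeMetric (g : ℝ → SmoothMetric E M) (p : M) (q : E × ℝ) :
    E × ℝ →L[ℝ] E × ℝ →L[ℝ] ℝ :=
  (coordMetric (g q.2) p q.1).bilinearComp
      (ContinuousLinearMap.fst ℝ E ℝ) (ContinuousLinearMap.fst ℝ E ℝ)
    + (ContinuousLinearMap.mul ℝ ℝ).bilinearComp
      (ContinuousLinearMap.snd ℝ E ℝ) (ContinuousLinearMap.snd ℝ E ℝ)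

/-! ### Families of closed curves `c : S¹ × [0,T] → M`
The circle is parametrized by the angle `x ∈ ℝ` through `x ↦ exp (i x)`. -/

variable (E) in
/-- `X = c_*(∂_x)`, the velocity of the curve `c(·,t)`. -/
def velocity (c : Circle → ℝ → M) (x t : ℝ) :
    TangentSpace 𝓘(ℝ, E) (c (Circle.exp x) t) :=
  mfderiv 𝓘(ℝ, ℝ) 𝓘(ℝ, E) (fun ξ : ℝ => c (Circle.exp ξ) t) x (1 : ℝ)

/-- `|X|`, measured by `g(t)`. -/
def speed (g : ℝ → SmoothMetric E M) (c : Circle → ℝ → M) (x t : ℝ) : ℝ :=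
  Real.sqrt ((g t).inner (c (Circle.exp x) t) (velocity E c x t) (velocity E c x t))

/-- The derivative `f' = ∂f/∂s = |X|⁻¹ ∂f/∂x` with respect to arc length `s` along `c(·,t)`
of a function `f(x,t)`. -/
def arcDeriv (g : ℝ → SmoothMetric E M) (c : Circle → ℝ → M) (f : ℝ → ℝ → ℝ) (x t : ℝ) : ℝ :=
  (speed g c x t)⁻¹ * deriv (fun ξ => f ξ t) x

variable (E) in
/-- The curve `c(·,t)` in the coordinates given by the chart around `p`. -/
def coordCurve (c : Circle → ℝ → M) (p : M) (t x : ℝ) : E :=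
  extChartAt 𝓘(ℝ, E) p (c (Circle.exp x) t)

/-- The unit tangent vector `S = X / |X|`, in the coordinates given by the chart around `p`. -/
def coordUnitTangent (g : ℝ → SmoothMetric E M) (c : Circle → ℝ → M) (p : M) (t x : ℝ) : E :=
  (speed g c x t)⁻¹ • deriv (coordCurve E c p t) x

/-- The curvature vector `H = ∇_S S` of `c(·,t)` with respect to `g(t)`, in the coordinates
given by the chart around `p`. -/
def coordCurvatureVector (g : ℝ → SmoothMetric E M) (c : Circle → ℝ → M) (p : M) (t x : ℝ) : E :=
  (speed g c x t)⁻¹ •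
    covDerivAlong (chartDomain E p) (coordMetric (g t) p) (coordCurve E c p t)
      (coordUnitTangent g c p t) x

/-- `c` is a (smooth) curve-shrinking flow in the ambient flow `g(t)`, `t ∈ [0,T]`: a smooth
family of immersed closed curves with `∂c/∂t = H` (in all charts). -/
structure IsCurveShrinkingFlow (T : ℝ) (g : ℝ → SmoothMetric E M) (c : Circle → ℝ → M) :
    Prop where
  smooth : ContMDiffOn ((𝓡 1).prod 𝓘(ℝ, ℝ)) 𝓘(ℝ, E) ∞ (fun q : Circle × ℝ => c q.1 q.2)
    (univ ×ˢ Icc 0 T)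
  immersed : ∀ x : ℝ, ∀ t ∈ Icc 0 T, velocity E c x t ≠ 0
  flow : ∀ p : M, ∀ x : ℝ, ∀ t ∈ Icc 0 T, c (Circle.exp x) t ∈ (chartAt E p).source →
    HasDerivWithinAt (fun τ => coordCurve E c p τ x) (coordCurvatureVector g c p t x) (Icc 0 T) t

/-- The curvature `k = |H|` of the curve `c(·,t)` at `x`
(computed in the chart around the point `c(x,t)`). -/
def curvature (g : ℝ → SmoothMetric E M) (c : Circle → ℝ → M) (x t : ℝ) : ℝ :=
  let p := c (Circle.exp x) t
  let H := coordCurvatureVector g c p t x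
  Real.sqrt (coordMetric (g t) p (coordCurve E c p t x) H H)

/-- `h_ε = √(k² + ε²)`. -/
def regCurvature (g : ℝ → SmoothMetric E M) (c : Circle → ℝ → M) (ε x t : ℝ) : ℝ :=
  Real.sqrt (curvature g c x t ^ 2 + ε ^ 2)

/-- `⟨(∇_S H)^⊥, (∇_S H)^⊥⟩`, where `∇` is the Levi-Civita connection of `ĝ` on `M × [0,T]`, the
inner product is that of `ĝ`, and `⊥` is the component orthogonal to `S`
(computed in the chart around the point `c(x,t)`). -/
def normSqPerpDerivH (T : ℝ) (g : ℝ → SmoothMetric E M) (c : Circle → ℝ → M) (x t : ℝ) : ℝ :=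
  let p := c (Circle.exp x) t
  let q : E × ℝ := (coordCurve E c p t x, t)
  let S : E × ℝ := (coordUnitTangent g c p t x, 0)
  let W : E × ℝ := (speed g c x t)⁻¹ •
    covDerivAlong (chartDomain E p ×ˢ Icc 0 T) (coordSpacetimeMetric g p)
      (fun ξ => (coordCurve E c p t ξ, t)) (fun ξ => (coordCurvatureVector g c p t ξ, (0 : ℝ))) x
  let Wperp : E × ℝ := W - coordSpacetimeMetric g p q W S • S
  coordSpacetimeMetric g p q Wperp Wperp

end Flow

end

noncomputable section

set_option maxSynthPendingDepth 3

/-! ### Directional derivatives within a set -/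

section DirectionalDerivative

variable {P V W : Type*} [NormedAddCommGroup P] [NormedSpace ℝ P]
  [NormedAddCommGroup V] [NormedSpace ℝ V] [NormedAddCommGroup W] [NormedSpace ℝ W]

/-! Pull the tangent bundle of M back to the parameter domain by c, with the metric g(t) and the
covariant derivatives ∇_x, ∇_t formed from the Christoffel symbols Γ of g(t). Then ∇_x is metric,
∇_t is metric up to Q = ∂g/∂t, torsion-freeness reads ∇_t X = ∇_x H, and ∇_t, ∇_x commute up to a
zeroth-order term F. Put D = |X|⁻¹∇_x. Differentiating |S| = 1 and ⟨H,S⟩ = 0 gives H ⊥ S and ⟨DH,S⟩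
= -k², hence [∂_t,∂_s] = a ∂_s with a = k² - Q(S,S)/2. Applying ∇_t to H = DS yields the exact
identity `PulledBackFlow.pd_t_normSq_H`: ∂_t k² = (k²)'' - 2|DH|² + 4k⁴ + Q(H,H) - 2Q(S,S)k² +
2⟨|X|⁻¹F S,H⟩.

Since |DH|² = |(DH)^⊥|² + k⁴, the quartic term becomes 2k⁴. The connection of ĝ adds the time
component -Q(S,H)/2 to DH, so the quantity in the theorem is |(DH)^⊥|² + Q(S,H)²/4; the correction
is O(k²). All other terms are O(k² + k) wherever g, Q, Γ and the derivative of Γ are bounded, the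
linear term in k coming from the time derivative of Γ in F. This is `IsCoordFlow.pd_t_normSq_H_le`.

The geometric quantities are defined in the chart centred at the moving point c(x,t), so they are
first shown to agree with their expressions in any fixed chart (`curvature_sq_eq`,
`normSqPerpDerivH_eq`). Bounds then hold on a compact ball in a chart times [0,T], independently of
c, and finitely many such balls cover the compact M.

For h, the Kato-type inequality (k²)'² ≤ 4k²|(DH)^⊥|² gives h'² ≤ |(DH)^⊥|². Thus in 2hh'' + 2h'² =
(k²)'' the gradient term is absorbed by the good term, and dividing by 2h ≥ 2k gives the second
inequality (`evolution_regCurvature`). -/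

/-- The derivative of `f` within `s` in the direction `e`, as a function of the point. -/
def pd (s : Set P) (e : P) (f : P → V) (q : P) : V := fderivWithin ℝ f s q e

variable {s : Set P} {e : P} {q : P}

theorem contDiffOn_pd (hs : UniqueDiffOn ℝ s) {f : P → V} (hf : ContDiffOn ℝ ∞ f s) :
    ContDiffOn ℝ ∞ (pd s e f) s :=
  (hf.fderivWithin hs (m := ∞) (by simp)).clm_apply contDiffOn_const

theorem ContDiffOn.differentiableWithinAt_of_mem {f : P → V} (hf : ContDiffOn ℝ ∞ f s)
    (hq : q ∈ s) : DifferentiableWithinAt ℝ f s q :=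
  hf.differentiableOn (by simp) q hq

theorem pd_congr {f f' : P → V} (h : EqOn f f' s) (hq : q ∈ s) : pd s e f q = pd s e f' q := by
  simp only [pd]
  rw [fderivWithin_congr h (h hq)]

theorem two_le_infty : (2 : ℕ∞ω) ≤ ∞ := by
  change ((2 : ℕ∞) : ℕ∞ω) ≤ _
  exact WithTop.coe_le_coe.2 le_top

/-- Requiring only the closure of the interior makes mixed partials commute at the boundary times t
= 0 and t = T as well. -/
theorem pd_comm (hs : UniqueDiffOn ℝ s) (hs' : s ⊆ closure (interior s)) {f : P → V}
    (hf : ContDiffOn ℝ ∞ f s) (hq : q ∈ s) (e e' : P) :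
    pd s e (pd s e' f) q = pd s e' (pd s e f) q := by
  have h1 : ∀ a : P, pd s a (fderivWithin ℝ f s) q = fderivWithin ℝ (fderivWithin ℝ f s) s q a :=
    fun a => rfl
  have hd : DifferentiableWithinAt ℝ (fderivWithin ℝ f s) s q :=
    (hf.fderivWithin hs (m := ∞) (by simp)).differentiableWithinAt_of_mem hq
  have h2 : ∀ a b : P, pd s a (pd s b f) q = fderivWithin ℝ (fderivWithin ℝ f s) s q a b := by
    intro a b
    have : pd s b f = fun q => (fderivWithin ℝ f s q) b := rfl
    rw [this]
    simp only [pd]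
    rw [fderivWithin_clm_apply (hs q hq) hd (differentiableWithinAt_const b)]
    simp
  rw [h2, h2]
  exact ContDiffWithinAt.isSymmSndFDerivWithinAt (n := 2) ((hf q hq).of_le two_le_infty)
    (by simp) hs (hs' hq) hq _ _

theorem pd_const (a : V) : pd s e (fun _ => a) q = 0 := by
  simp [pd]

theorem pd_add (hs : UniqueDiffOn ℝ s) {f f' : P → V} (hf : ContDiffOn ℝ ∞ f s)
    (hf' : ContDiffOn ℝ ∞ f' s) (hq : q ∈ s) :
    pd s e (fun z => f z + f' z) q = pd s e f q + pd s e f' q := by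
  simp only [pd]
  rw [fderivWithin_fun_add (hs q hq) (hf.differentiableWithinAt_of_mem hq)
    (hf'.differentiableWithinAt_of_mem hq)]
  simp

theorem pd_smul (hs : UniqueDiffOn ℝ s) {f : P → ℝ} {v : P → V} (hf : ContDiffOn ℝ ∞ f s)
    (hv : ContDiffOn ℝ ∞ v s) (hq : q ∈ s) :
    pd s e (fun z => f z • v z) q = pd s e f q • v q + f q • pd s e v q := by
  simp only [pd]
  rw [fderivWithin_fun_smul (hs q hq) (hf.differentiableWithinAt_of_mem hq)
    (hv.differentiableWithinAt_of_mem hq)]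
  simp [add_comm]

theorem pd_clm_apply (hs : UniqueDiffOn ℝ s) {L : P → V →L[ℝ] W} {v : P → V}
    (hL : ContDiffOn ℝ ∞ L s) (hv : ContDiffOn ℝ ∞ v s) (hq : q ∈ s) :
    pd s e (fun z => L z (v z)) q = pd s e L q (v q) + L q (pd s e v q) := by
  simp only [pd]
  rw [fderivWithin_clm_apply (hs q hq) (hL.differentiableWithinAt_of_mem hq)
    (hv.differentiableWithinAt_of_mem hq)]
  simp [add_comm]

theorem pd_mul (hs : UniqueDiffOn ℝ s) {f v : P → ℝ} (hf : ContDiffOn ℝ ∞ f s)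
    (hv : ContDiffOn ℝ ∞ v s) (hq : q ∈ s) :
    pd s e (fun z => f z * v z) q = pd s e f q * v q + f q * pd s e v q :=
  pd_smul hs hf hv hq

theorem pd_sq (hs : UniqueDiffOn ℝ s) {f : P → ℝ} (hf : ContDiffOn ℝ ∞ f s) (hq : q ∈ s) :
    pd s e (fun z => f z ^ 2) q = 2 * f q * pd s e f q := by
  simp only [pow_two]
  rw [pd_mul hs hf hf hq]
  ring

end DirectionalDerivative

/-! ### A vector bundle with metric and connection over a surface -/

section PulledBack

variable {V : Type*} [NormedAddCommGroup V] [NormedSpace ℝ V]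

/-- The length of `X` with respect to `g`. -/
def len (g : ℝ × ℝ → V →L[ℝ] V →L[ℝ] ℝ) (X : ℝ × ℝ → V) (q : ℝ × ℝ) : ℝ :=
  Real.sqrt (g q (X q) (X q))

/-- The vector field `X / |X|`. -/
def unitField (g : ℝ × ℝ → V →L[ℝ] V →L[ℝ] ℝ) (X : ℝ × ℝ → V) (q : ℝ × ℝ) : V :=
  (len g X q)⁻¹ • X q

/-- The covariant derivative in the direction `e` with connection form `A`. -/
def cov (s : Set (ℝ × ℝ)) (e : ℝ × ℝ) (A : ℝ × ℝ → V →L[ℝ] V) (Y : ℝ × ℝ → V) (q : ℝ × ℝ) : V :=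
  pd s e Y q + A q (Y q)

/-- The curvature of the connection with forms `Ax`, `At`. -/
def bundleCurvature (s : Set (ℝ × ℝ)) (Ax At : ℝ × ℝ → V →L[ℝ] V) (q : ℝ × ℝ) (v : V) : V :=
  pd s (0, 1) Ax q v - pd s (1, 0) At q v + At q (Ax q v) - Ax q (At q v)

/-- A curve-shrinking flow, described through the pullback to the parameter domain `s` of the
tangent bundle with its (time-dependent) metric `g` and the connection forms `Ax`, `At`;
`Q` is the time derivative of the metric. -/
structure PulledBackFlow (s : Set (ℝ × ℝ)) (g Q : ℝ × ℝ → V →L[ℝ] V →L[ℝ] ℝ)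
    (Ax At : ℝ × ℝ → V →L[ℝ] V) (X H : ℝ × ℝ → V) : Prop where
  unique : UniqueDiffOn ℝ s
  closure : s ⊆ closure (interior s)
  smooth_g : ContDiffOn ℝ ∞ g s
  smooth_Ax : ContDiffOn ℝ ∞ Ax s
  smooth_At : ContDiffOn ℝ ∞ At s
  smooth_X : ContDiffOn ℝ ∞ X s
  smooth_H : ContDiffOn ℝ ∞ H s
  symm : ∀ q ∈ s, ∀ v w, g q v w = g q w v
  pos : ∀ q ∈ s, 0 < g q (X q) (X q)
  compat_x : ∀ q ∈ s, ∀ v w, pd s (1, 0) g q v w = g q (Ax q v) w + g q v (Ax q w)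
  compat_t : ∀ q ∈ s, ∀ v w, pd s (0, 1) g q v w = Q q v w + g q (At q v) w + g q v (At q w)
  torsion : ∀ q ∈ s, cov s (0, 1) At X q = cov s (1, 0) Ax H q
  flow : ∀ q ∈ s, H q = (len g X q)⁻¹ • cov s (1, 0) Ax (unitField g X) q

theorem contDiffOn_cov {s : Set (ℝ × ℝ)} (hs : UniqueDiffOn ℝ s) {A : ℝ × ℝ → V →L[ℝ] V}
    {Y : ℝ × ℝ → V} (hA : ContDiffOn ℝ ∞ A s) (hY : ContDiffOn ℝ ∞ Y s) {e : ℝ × ℝ} :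
    ContDiffOn ℝ ∞ (cov s e A Y) s :=
  (contDiffOn_pd hs hY).add (hA.clm_apply hY)

theorem cov_congr {s : Set (ℝ × ℝ)} {e q : ℝ × ℝ} {A : ℝ × ℝ → V →L[ℝ] V} {Y Y' : ℝ × ℝ → V}
    (h : EqOn Y Y' s) (hq : q ∈ s) : cov s e A Y q = cov s e A Y' q := by
  simp only [cov, pd_congr h hq, h hq]

theorem cov_add {s : Set (ℝ × ℝ)} (hs : UniqueDiffOn ℝ s) {e q : ℝ × ℝ} {A : ℝ × ℝ → V →L[ℝ] V}
    {Y Y' : ℝ × ℝ → V} (hY : ContDiffOn ℝ ∞ Y s) (hY' : ContDiffOn ℝ ∞ Y' s) (hq : q ∈ s) :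
    cov s e A (fun z => Y z + Y' z) q = cov s e A Y q + cov s e A Y' q := by
  simp only [cov, pd_add hs hY hY' hq, map_add]
  abel

theorem cov_smul {s : Set (ℝ × ℝ)} (hs : UniqueDiffOn ℝ s) {e q : ℝ × ℝ} {A : ℝ × ℝ → V →L[ℝ] V}
    {f : ℝ × ℝ → ℝ} {Y : ℝ × ℝ → V} (hf : ContDiffOn ℝ ∞ f s) (hY : ContDiffOn ℝ ∞ Y s)
    (hq : q ∈ s) :
    cov s e A (fun z => f z • Y z) q = pd s e f q • Y q + f q • cov s e A Y q := by
  simp only [cov, pd_smul hs hf hY hq, map_smul, smul_add]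
  abel

/-- The mixed partials of Y cancel, and so do the first-order terms in Y; only a term linear in the
value of Y remains. -/
theorem cov_comm {s : Set (ℝ × ℝ)} (hs : UniqueDiffOn ℝ s) (hs' : s ⊆ closure (interior s))
    {Ax At : ℝ × ℝ → V →L[ℝ] V} (hAx : ContDiffOn ℝ ∞ Ax s) (hAt : ContDiffOn ℝ ∞ At s)
    {Y : ℝ × ℝ → V} (hY : ContDiffOn ℝ ∞ Y s) {q : ℝ × ℝ} (hq : q ∈ s) :
    cov s (0, 1) At (cov s (1, 0) Ax Y) q
      = cov s (1, 0) Ax (cov s (0, 1) At Y) q + bundleCurvature s Ax At q (Y q) := by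
  have h1 : cov s (1, 0) Ax Y = fun z => pd s (1, 0) Y z + Ax z (Y z) := rfl
  have h2 : cov s (0, 1) At Y = fun z => pd s (0, 1) Y z + At z (Y z) := rfl
  rw [h1, h2, cov_add hs (contDiffOn_pd hs hY) (hAx.clm_apply hY) hq,
    cov_add hs (contDiffOn_pd hs hY) (hAt.clm_apply hY) hq]
  simp only [cov, bundleCurvature, pd_clm_apply hs hAx hY hq, pd_clm_apply hs hAt hY hq]
  rw [pd_comm hs hs' hY hq]
  abel

/-! ### Evolution of length element, unit tangent and curvature -/

namespace PulledBackFlow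

variable {s : Set (ℝ × ℝ)} {g Q : ℝ × ℝ → V →L[ℝ] V →L[ℝ] ℝ}
    {Ax At : ℝ × ℝ → V →L[ℝ] V} {X H : ℝ × ℝ → V} {q : ℝ × ℝ}

theorem len_pos (h : PulledBackFlow s g Q Ax At X H) (hq : q ∈ s) : 0 < len g X q :=
  Real.sqrt_pos.2 (h.pos q hq)

theorem len_sq (h : PulledBackFlow s g Q Ax At X H) (hq : q ∈ s) :
    len g X q ^ 2 = g q (X q) (X q) :=
  Real.sq_sqrt (h.pos q hq).le

theorem smooth_inner (h : PulledBackFlow s g Q Ax At X H) {Y Z : ℝ × ℝ → V}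
    (hY : ContDiffOn ℝ ∞ Y s) (hZ : ContDiffOn ℝ ∞ Z s) :
    ContDiffOn ℝ ∞ (fun q => g q (Y q) (Z q)) s :=
  (h.smooth_g.clm_apply hY).clm_apply hZ

theorem smooth_len (h : PulledBackFlow s g Q Ax At X H) : ContDiffOn ℝ ∞ (len g X) s :=
  (h.smooth_inner h.smooth_X h.smooth_X).sqrt fun q hq => (h.pos q hq).ne'

theorem smooth_inv_len (h : PulledBackFlow s g Q Ax At X H) :
    ContDiffOn ℝ ∞ (fun q => (len g X q)⁻¹) s :=
  h.smooth_len.inv fun _ hq => (h.len_pos hq).ne'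

theorem smooth_unit (h : PulledBackFlow s g Q Ax At X H) : ContDiffOn ℝ ∞ (unitField g X) s :=
  h.smooth_inv_len.smul h.smooth_X

theorem pd_inner_x (h : PulledBackFlow s g Q Ax At X H) {Y Z : ℝ × ℝ → V}
    (hY : ContDiffOn ℝ ∞ Y s) (hZ : ContDiffOn ℝ ∞ Z s) (hq : q ∈ s) :
    pd s (1, 0) (fun q => g q (Y q) (Z q)) q
      = g q (cov s (1, 0) Ax Y q) (Z q) + g q (Y q) (cov s (1, 0) Ax Z q) := by
  rw [pd_clm_apply h.unique (h.smooth_g.clm_apply hY) hZ hq,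
    pd_clm_apply h.unique h.smooth_g hY hq]
  simp only [cov, map_add, add_apply, h.compat_x q hq]
  ring

theorem pd_inner_t (h : PulledBackFlow s g Q Ax At X H) {Y Z : ℝ × ℝ → V}
    (hY : ContDiffOn ℝ ∞ Y s) (hZ : ContDiffOn ℝ ∞ Z s) (hq : q ∈ s) :
    pd s (0, 1) (fun q => g q (Y q) (Z q)) q
      = Q q (Y q) (Z q) + g q (cov s (0, 1) At Y q) (Z q)
        + g q (Y q) (cov s (0, 1) At Z q) := by
  rw [pd_clm_apply h.unique (h.smooth_g.clm_apply hY) hZ hq,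
    pd_clm_apply h.unique h.smooth_g hY hq]
  simp only [cov, map_add, add_apply, h.compat_t q hq]
  ring

theorem inner_unit_unit (h : PulledBackFlow s g Q Ax At X H) (hq : q ∈ s) :
    g q (unitField g X q) (unitField g X q) = 1 := by
  have := h.len_pos hq
  simp only [unitField, map_smul, smul_apply, smul_eq_mul, ← h.len_sq hq]
  field_simp

theorem cov_unit (h : PulledBackFlow s g Q Ax At X H) (hq : q ∈ s) :
    cov s (1, 0) Ax (unitField g X) q = len g X q • H q := by
  rw [h.flow q hq, smul_smul, mul_inv_cancel₀ (h.len_pos hq).ne', one_smul]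

theorem X_eq (h : PulledBackFlow s g Q Ax At X H) (hq : q ∈ s) :
    X q = len g X q • unitField g X q := by
  rw [unitField, smul_smul, mul_inv_cancel₀ (h.len_pos hq).ne', one_smul]

/-- A vector field of constant length is orthogonal to its covariant derivative; here the field is
S, with ∇_x S = |X| H. -/
theorem inner_H_unit (h : PulledBackFlow s g Q Ax At X H) (hq : q ∈ s) :
    g q (H q) (unitField g X q) = 0 := by
  have h1 := h.pd_inner_x h.smooth_unit h.smooth_unit hq
  have h2 : pd s (1, 0) (fun q => g q (unitField g X q) (unitField g X q)) q = 0 := by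
    rw [pd_congr (f' := fun _ => (1 : ℝ)) (fun z hz => h.inner_unit_unit hz) hq,
      pd_const]
  have h3 := h.len_pos hq
  rw [h2, h.cov_unit hq, h.symm q hq (unitField g X q)] at h1
  simp only [map_smul, smul_apply, smul_eq_mul] at h1
  have : len g X q * g q (H q) (unitField g X q) = 0 := by linarith
  exact (mul_eq_zero.1 this).resolve_left h3.ne'

/-- The component of `∇_S H` in the direction of `S` is `-k²`. -/
theorem inner_cov_H_unit (h : PulledBackFlow s g Q Ax At X H) (hq : q ∈ s) :
    g q (cov s (1, 0) Ax H q) (unitField g X q) = - (len g X q * g q (H q) (H q)) := by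
  have h1 := h.pd_inner_x h.smooth_H h.smooth_unit hq
  have h2 : pd s (1, 0) (fun q => g q (H q) (unitField g X q)) q = 0 := by
    rw [pd_congr (f' := fun _ => (0 : ℝ)) (fun z hz => h.inner_H_unit hz) hq,
      pd_const]
  rw [h2, h.cov_unit hq] at h1
  simp only [map_smul, smul_eq_mul] at h1
  linarith

/-- The evolution of the length element. -/
theorem pd_t_len (h : PulledBackFlow s g Q Ax At X H) (hq : q ∈ s) :
    pd s (0, 1) (len g X) q
      = len g X q * (Q q (unitField g X q) (unitField g X q) / 2 - g q (H q) (H q)) := by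
  have h1 := h.pd_inner_t h.smooth_X h.smooth_X hq
  -- Torsion-freeness replaces ∇_t X by ∇_x H, whose S-component is already known.
  rw [← pd_congr (f := fun q => len g X q ^ 2) (fun z hz => h.len_sq hz) hq,
    pd_sq h.unique h.smooth_len hq, h.symm q hq (X q), h.torsion q hq, h.X_eq hq] at h1
  simp only [map_smul, smul_apply, smul_eq_mul, h.inner_cov_H_unit hq] at h1
  have h3 := h.len_pos hq
  apply mul_left_cancel₀ h3.ne'
  linarith

theorem pd_t_inv_len (h : PulledBackFlow s g Q Ax At X H) (hq : q ∈ s) :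
    pd s (0, 1) (fun q => (len g X q)⁻¹) q
      = (len g X q)⁻¹ * (g q (H q) (H q) - Q q (unitField g X q) (unitField g X q) / 2) := by
  have h3 := h.len_pos hq
  have h1 := pd_mul (e := (0, 1)) h.unique h.smooth_len h.smooth_inv_len hq
  rw [pd_congr (f' := fun _ => (1 : ℝ)) (fun z hz => mul_inv_cancel₀ (h.len_pos hz).ne') hq,
    pd_const, h.pd_t_len hq] at h1
  apply mul_left_cancel₀ h3.ne'
  field_simp at h1 ⊢
  linarith

theorem pd_x_normSq_H (h : PulledBackFlow s g Q Ax At X H) (hq : q ∈ s) :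
    pd s (1, 0) (fun q => g q (H q) (H q)) q = 2 * g q (cov s (1, 0) Ax H q) (H q) := by
  rw [h.pd_inner_x h.smooth_H h.smooth_H hq, h.symm q hq (H q)]
  ring

/-- The evolution of `k²` along the flow. -/
theorem pd_t_normSq_H (h : PulledBackFlow s g Q Ax At X H) (hq : q ∈ s) :
    pd s (0, 1) (fun q => g q (H q) (H q)) q
      = (len g X q)⁻¹ *
          pd s (1, 0) (fun q => (len g X q)⁻¹ * pd s (1, 0) (fun q => g q (H q) (H q)) q) q
        - 2 * g q ((len g X q)⁻¹ • cov s (1, 0) Ax H q) ((len g X q)⁻¹ • cov s (1, 0) Ax H q)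
        + 4 * g q (H q) (H q) ^ 2 + Q q (H q) (H q)
        - 2 * Q q (unitField g X q) (unitField g X q) * g q (H q) (H q)
        + 2 * g q ((len g X q)⁻¹ • bundleCurvature s Ax At q (unitField g X q)) (H q) := by
  set l : ℝ × ℝ → ℝ := fun q => (len g X q)⁻¹ with hl
  set S := unitField g X with hS
  -- This is the factor in [∂_t,∂_s] = a ∂_s. Its explicit value is needed only at q, although a is
  -- differentiated below.
  set a : ℝ × ℝ → ℝ := fun q => pd s (0, 1) l q * len g X q with ha
  have sa : ContDiffOn ℝ ∞ a s := (contDiffOn_pd h.unique h.smooth_inv_len).mul h.smooth_len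
  have sDH : ContDiffOn ℝ ∞ (cov s (1, 0) Ax H) s := contDiffOn_cov h.unique h.smooth_Ax h.smooth_H
  have sE : ContDiffOn ℝ ∞ (fun z => l z • cov s (1, 0) Ax H z) s := h.smooth_inv_len.smul sDH
  have sDS : ContDiffOn ℝ ∞ (cov s (1, 0) Ax S) s :=
    contDiffOn_cov h.unique h.smooth_Ax h.smooth_unit
  have aval : a q = g q (H q) (H q) - Q q (S q) (S q) / 2 := by
    have h3 := h.len_pos hq
    simp only [ha, hl, h.pd_t_inv_len hq, hS]
    field_simp
  -- the evolution of the unit tangent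
  have hDtS : EqOn (cov s (0, 1) At S) (fun z => a z • S z + l z • cov s (1, 0) Ax H z) s := by
    intro z hz
    have h3 := h.len_pos hz
    have : cov s (0, 1) At S z = pd s (0, 1) l z • X z + l z • cov s (0, 1) At X z :=
      cov_smul h.unique h.smooth_inv_len h.smooth_X hz
    simp only []
    rw [this, h.torsion z hz, h.X_eq hz, smul_smul]
  -- Differentiate H = |X|⁻¹∇_x S in time and move ∇_t past ∇_x, at the price of the curvature term.
  have hDtH : cov s (0, 1) At H q = a q • H q + l q • (cov s (1, 0) Ax (cov s (0, 1) At S) q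
      + bundleCurvature s Ax At q (S q)) := by
    have h3 := h.len_pos hq
    rw [cov_congr (Y' := fun z => l z • cov s (1, 0) Ax S z) (fun z hz => h.flow z hz) hq,
      cov_smul h.unique h.smooth_inv_len sDS hq,
      cov_comm h.unique h.closure h.smooth_Ax h.smooth_At h.smooth_unit hq, h.cov_unit hq,
      smul_smul]
  rw [cov_congr hDtS hq, cov_add (Y := fun z => a z • S z)
      (Y' := fun z => l z • cov s (1, 0) Ax H z) h.unique (sa.smul h.smooth_unit) sE hq,
    cov_smul h.unique sa h.smooth_unit hq, h.cov_unit hq] at hDtH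
  have hxx : pd s (1, 0) (fun q => l q * pd s (1, 0) (fun q => g q (H q) (H q)) q) q
      = 2 * (g q (cov s (1, 0) Ax (fun z => l z • cov s (1, 0) Ax H z) q) (H q)
        + g q (l q • cov s (1, 0) Ax H q) (cov s (1, 0) Ax H q)) := by
    rw [← h.pd_inner_x sE h.smooth_H hq]
    rw [pd_congr (f' := fun z => (fun _ => (2 : ℝ)) z * g z (l z • cov s (1, 0) Ax H z) (H z)) _ hq,
      pd_mul h.unique contDiffOn_const (h.smooth_inner sE h.smooth_H) hq,
      pd_const]
    · ring
    · intro z hz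
      simp only [h.pd_x_normSq_H hz, map_smul, smul_apply, smul_eq_mul]
      ring
  -- In ∇_x(aS) = (∂_x a) S + a|X| H the first summand is orthogonal to H, so ∂_x a never has to be
  -- computed.
  have hSH : g q (unitField g X q) (H q) = 0 := by rw [h.symm q hq, h.inner_H_unit hq]
  have h3 := h.len_pos hq
  have hl1 : l q * len g X q = 1 := inv_mul_cancel₀ h3.ne'
  rw [h.pd_inner_t h.smooth_H h.smooth_H hq, h.symm q hq (H q), hDtH, hxx]
  simp only [hS] at aval ⊢
  change _ = l q * _ - 2 * g q (l q • _) (l q • _) + _ + _ - _ + 2 * g q (l q • _) _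
  simp only [map_smul, map_add, smul_apply, add_apply,
    smul_eq_mul, hSH, aval]
  have := congrArg (fun r => r * (g q (H q) (H q)
    - Q q (unitField g X q) (unitField g X q) / 2) * g q (H q) (H q)) hl1
  -- The term aH occurs twice in ∇_t H, once from the time derivative of |X|⁻¹ and once from D(aS);
  -- hence the total 4ak² = 4k⁴ - 2Q(S,S)k².
  linear_combination 2 * this

end PulledBackFlow

end PulledBack

/-! ### The Christoffel symbols of a metric with given first derivatives -/

section Christoffel

variable {F : Type*} [NormedAddCommGroup F] [NormedSpace ℝ F]

/-- The linear form `2 G(Γ(u,v),·)`, in terms of the derivative `D` of the metric `G`. -/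
def koszulForm (D : F →L[ℝ] F →L[ℝ] F →L[ℝ] ℝ) (u v : F) : F →L[ℝ] ℝ :=
  D u v + D v u - (D.flip u).flip v

/-- The Christoffel symbols of a metric with value `B` and derivative `D`, as a bilinear map. -/
def christoffelForm (B : F →L[ℝ] F →L[ℝ] ℝ) (D : F →L[ℝ] F →L[ℝ] F →L[ℝ] ℝ) :
    F →L[ℝ] F →L[ℝ] F :=
  (ContinuousLinearMap.compL ℝ F (F →L[ℝ] ℝ) F B.inverse).comp
    ((1 / 2 : ℝ) • (D + D.flip -
      (ContinuousLinearMap.flipₗᵢ ℝ F F ℝ).toContinuousLinearEquiv.toContinuousLinearMap.comp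
        D.flip))

theorem christoffelForm_apply (B : F →L[ℝ] F →L[ℝ] ℝ) (D : F →L[ℝ] F →L[ℝ] F →L[ℝ] ℝ)
    (u v : F) : christoffelForm B D u v = B.inverse ((1 / 2 : ℝ) • koszulForm D u v) := rfl

theorem christoffel_eq (s : Set F) (G : F → F →L[ℝ] F →L[ℝ] ℝ) (y u v : F) :
    christoffel s G y u v = christoffelForm (G y) (fderivWithin ℝ G s y) u v := rfl

/-- Positive definiteness of a bilinear form. -/
def IsPosDef (B : F →L[ℝ] F →L[ℝ] ℝ) : Prop := ∀ u, u ≠ 0 → 0 < B u u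

theorem IsPosDef.nonneg {B : F →L[ℝ] F →L[ℝ] ℝ} (hB : IsPosDef B) (u : F) : 0 ≤ B u u := by
  rcases eq_or_ne u 0 with rfl | h
  · simp
  · exact (hB u h).le

theorem IsPosDef.inner_sq_le {B : F →L[ℝ] F →L[ℝ] ℝ} (hB : IsPosDef B)
    (hs : ∀ u v, B u v = B v u) (u v : F) : B u v ^ 2 ≤ B u u * B v v := by
  rcases eq_or_ne v 0 with rfl | hv
  · simp
  have h1 := hB v hv
  -- A multiple of the component of u orthogonal to v, scaled to avoid division.
  have h2 := hB.nonneg (B v v • u - B u v • v)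
  simp only [map_sub, map_smul, sub_apply, smul_apply, smul_eq_mul, hs v u] at h2
  have h3 : 0 ≤ B v v * (B u u * B v v - B u v ^ 2) := by linarith
  linarith [nonneg_of_mul_nonneg_right h3 h1]

theorem IsPosDef.injective {B : F →L[ℝ] F →L[ℝ] ℝ} (hB : IsPosDef B) : Function.Injective B := by
  rw [injective_iff_map_eq_zero]
  intro u hu
  by_contra h
  have := hB u h
  simp [hu] at this

theorem IsPosDef.isInvertible [FiniteDimensional ℝ F] {B : F →L[ℝ] F →L[ℝ] ℝ} (hB : IsPosDef B) :
    B.IsInvertible := by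
  have hr : Module.finrank ℝ F = Module.finrank ℝ (F →L[ℝ] ℝ) := by
    rw [← (LinearMap.toContinuousLinearMap : (F →ₗ[ℝ] ℝ) ≃ₗ[ℝ] (F →L[ℝ] ℝ)).finrank_eq]
    exact (Subspace.dual_finrank_eq (K := ℝ) (V := F)).symm
  refine ⟨(LinearMap.linearEquivOfInjective B.toLinearMap hB.injective hr).toContinuousLinearEquiv,
    ?_⟩
  ext u v
  rfl

variable [FiniteDimensional ℝ F]

theorem christoffelForm_inner {B : F →L[ℝ] F →L[ℝ] ℝ} (hB : IsPosDef B)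
    (D : F →L[ℝ] F →L[ℝ] F →L[ℝ] ℝ) (u v w : F) :
    B (christoffelForm B D u v) w = (1 / 2) * (D u v w + D v u w - D w u v) := by
  have : B (christoffelForm B D u v) = (1 / 2 : ℝ) • koszulForm D u v := by
    have h := hB.isInvertible.inverse_apply_eq (x := christoffelForm B D u v)
      (y := (1 / 2 : ℝ) • koszulForm D u v)
    exact (h.1 (christoffelForm_apply B D u v).symm).symm
  rw [this]
  rfl

/-- Uniqueness in the Koszul formula. Symmetry, the transformation law and the spacetime symbols are
all checked through it, without handling the inverse metric. -/
theorem christoffelForm_eq_of_inner {B : F →L[ℝ] F →L[ℝ] ℝ} (hB : IsPosDef B)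
    {D : F →L[ℝ] F →L[ℝ] F →L[ℝ] ℝ} {u v z : F}
    (h : ∀ w, B z w = (1 / 2) * (D u v w + D v u w - D w u v)) : christoffelForm B D u v = z := by
  apply hB.injective
  ext w
  rw [christoffelForm_inner hB, h]

theorem christoffelForm_symm {B : F →L[ℝ] F →L[ℝ] ℝ} (hB : IsPosDef B)
    {D : F →L[ℝ] F →L[ℝ] F →L[ℝ] ℝ} (hD : ∀ u v w, D u v w = D u w v) (u v : F) :
    christoffelForm B D u v = christoffelForm B D v u :=
  christoffelForm_eq_of_inner hB fun w => by rw [christoffelForm_inner hB, hD w u v]; ring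

theorem christoffelForm_compat {B : F →L[ℝ] F →L[ℝ] ℝ} (hB : IsPosDef B)
    (hs : ∀ u v, B u v = B v u)
    {D : F →L[ℝ] F →L[ℝ] F →L[ℝ] ℝ} (hD : ∀ u v w, D u v w = D u w v) (u v w : F) :
    D u v w = B (christoffelForm B D u v) w + B v (christoffelForm B D u w) := by
  rw [hs v, christoffelForm_inner hB, christoffelForm_inner hB, hD u w v, hD w u v, hD v u w]
  ring

/-- The transformation law of the Christoffel symbols, `L` being the derivative and `Φ` the second
derivative of the change of coordinates. -/
theorem christoffelForm_transform {F' : Type*} [NormedAddCommGroup F'] [NormedSpace ℝ F']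
    [FiniteDimensional ℝ F'] {B : F →L[ℝ] F →L[ℝ] ℝ} {B' : F' →L[ℝ] F' →L[ℝ] ℝ}
    (hB : IsPosDef B) (hB' : IsPosDef B') (hs' : ∀ u v, B' u v = B' v u)
    {D : F →L[ℝ] F →L[ℝ] F →L[ℝ] ℝ} {D' : F' →L[ℝ] F' →L[ℝ] F' →L[ℝ] ℝ}
    {L : F →L[ℝ] F'} (hL : Function.Surjective L) {Φ : F →L[ℝ] F →L[ℝ] F'}
    (hΦ : ∀ u v, Φ u v = Φ v u) (hBL : ∀ u v, B u v = B' (L u) (L v))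
    (hDL : ∀ w u v, D w u v = D' (L w) (L u) (L v) + B' (Φ w u) (L v) + B' (L u) (Φ w v))
    (u v : F) :
    Φ u v + christoffelForm B' D' (L u) (L v) = L (christoffelForm B D u v) := by
  suffices h : christoffelForm B' D' (L u) (L v) = L (christoffelForm B D u v) - Φ u v by
    rw [h]; abel
  apply christoffelForm_eq_of_inner hB'
  intro w'
  -- Test vectors may be taken in the image of L; the second-derivative terms then cancel by
  -- symmetry except for the one giving Φ u v.
  obtain ⟨w, rfl⟩ := hL w'
  rw [map_sub, sub_apply, ← hBL, christoffelForm_inner hB, hDL, hDL, hDL, hΦ v u, hΦ w u, hΦ w v,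
    hs' (L v), hs' (L u) (Φ v w)]
  ring

end Christoffel

/-! ### Metrics depending on time -/

section TimeDependent

variable {E : Type*} [NormedAddCommGroup E] [NormedSpace ℝ E] [FiniteDimensional ℝ E]

/-- The spatial part of the derivative of a time-dependent metric. -/
def spaceDeriv (U : Set (E × ℝ)) (G : E × ℝ → E →L[ℝ] E →L[ℝ] ℝ) (z : E × ℝ) :
    E →L[ℝ] E →L[ℝ] E →L[ℝ] ℝ :=
  (fderivWithin ℝ G U z).comp (ContinuousLinearMap.inl ℝ E ℝ)

/-- The time derivative of a time-dependent metric. -/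
def timeDeriv (U : Set (E × ℝ)) (G : E × ℝ → E →L[ℝ] E →L[ℝ] ℝ) (z : E × ℝ) :
    E →L[ℝ] E →L[ℝ] ℝ :=
  fderivWithin ℝ G U z (0, 1)

/-- The Christoffel symbols of a time-dependent metric. -/
def christoffelMap (U : Set (E × ℝ)) (G : E × ℝ → E →L[ℝ] E →L[ℝ] ℝ) (z : E × ℝ) :
    E →L[ℝ] E →L[ℝ] E :=
  christoffelForm (G z) (spaceDeriv U G z)

/-- A smooth family of metrics on `U`. -/
structure IsMetricFamily (U : Set (E × ℝ)) (G : E × ℝ → E →L[ℝ] E →L[ℝ] ℝ) : Prop where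
  unique : UniqueDiffOn ℝ U
  smooth : ContDiffOn ℝ ∞ G U
  symm : ∀ z ∈ U, ∀ u v, G z u v = G z v u
  posDef : ∀ z ∈ U, IsPosDef (G z)

theorem fderivWithin_apply_apply {P V W : Type*} [NormedAddCommGroup P] [NormedSpace ℝ P]
    [NormedAddCommGroup V] [NormedSpace ℝ V] [NormedAddCommGroup W] [NormedSpace ℝ W]
    {U : Set P} {B : P → V →L[ℝ] V →L[ℝ] W} {z : P} (hu : UniqueDiffWithinAt ℝ U z)
    (hB : DifferentiableWithinAt ℝ B U z) (w : P) (u v : V) :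
    fderivWithin ℝ (fun z => B z u v) U z w = fderivWithin ℝ B U z w u v := by
  rw [fderivWithin_clm_apply hu (hB.clm_apply (differentiableWithinAt_const u))
    (differentiableWithinAt_const v), fderivWithin_clm_apply hu hB (differentiableWithinAt_const u)]
  simp

namespace IsMetricFamily

variable {U : Set (E × ℝ)} {G : E × ℝ → E →L[ℝ] E →L[ℝ] ℝ}

omit [FiniteDimensional ℝ E] in
theorem fderivWithin_symm (h : IsMetricFamily U G) {z : E × ℝ} (hz : z ∈ U) (w : E × ℝ) (u v : E) :
    fderivWithin ℝ G U z w u v = fderivWithin ℝ G U z w v u := by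
  have hd := h.smooth.differentiableWithinAt_of_mem hz
  rw [← fderivWithin_apply_apply (h.unique z hz) hd, ← fderivWithin_apply_apply (h.unique z hz) hd]
  rw [fderivWithin_congr (fun y hy => h.symm y hy u v) (h.symm z hz u v)]

omit [FiniteDimensional ℝ E] in
theorem smooth_fderivWithin (h : IsMetricFamily U G) :
    ContDiffOn ℝ ∞ (fderivWithin ℝ G U) U := h.smooth.fderivWithin h.unique (m := ∞) (by simp)

/-- Inversion is smooth at invertible operators. As E is finite-dimensional, smoothness of the
remaining factors can be tested on fixed vectors. -/
theorem smooth_christoffelMap (h : IsMetricFamily U G) :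
    ContDiffOn ℝ ∞ (christoffelMap U G) U := by
  have h1 : ContDiffOn ℝ ∞ (fun z => (G z).inverse) U := fun z hz =>
    ((h.posDef z hz).isInvertible.contDiffAt_map_inverse (n := ∞)).comp_contDiffWithinAt z
      (h.smooth z hz)
  have h2 : ∀ w : E × ℝ, ContDiffOn ℝ ∞ (fun z => fderivWithin ℝ G U z w) U := fun w =>
    h.smooth_fderivWithin.clm_apply contDiffOn_const
  refine contDiffOn_clm_apply.2 fun u => contDiffOn_clm_apply.2 fun v => ?_
  change ContDiffOn ℝ ∞ (fun z => (G z).inverse ((1 / 2 : ℝ) • koszulForm (spaceDeriv U G z) u v)) U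
  suffices h4 : ContDiffOn ℝ ∞ (fun z => koszulForm (spaceDeriv U G z) u v) U from
    h1.clm_apply (h4.const_smul (1 / 2 : ℝ))
  refine contDiffOn_clm_apply.2 fun w => ?_
  change ContDiffOn ℝ ∞ (fun z => fderivWithin ℝ G U z (u, 0) v w + fderivWithin ℝ G U z (v, 0) u w
    - fderivWithin ℝ G U z (w, 0) u v) U
  have h3 : ∀ w u v, ContDiffOn ℝ ∞ (fun z => fderivWithin ℝ G U z w u v) U := fun w u v =>
    ((h2 w).clm_apply contDiffOn_const).clm_apply contDiffOn_const
  exact ((h3 _ _ _).add (h3 _ _ _)).sub (h3 _ _ _)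

theorem christoffelMap_symm (h : IsMetricFamily U G) {z : E × ℝ} (hz : z ∈ U) (u v : E) :
    christoffelMap U G z u v = christoffelMap U G z v u :=
  christoffelForm_symm (h.posDef z hz) (fun _ _ _ => h.fderivWithin_symm hz _ _ _) u v

theorem spaceDeriv_eq (h : IsMetricFamily U G) {z : E × ℝ} (hz : z ∈ U) (u v w : E) :
    fderivWithin ℝ G U z (u, 0) v w
      = G z (christoffelMap U G z u v) w + G z v (christoffelMap U G z u w) :=
  christoffelForm_compat (D := spaceDeriv U G z) (h.posDef z hz) (h.symm z hz)
    (fun _ _ _ => h.fderivWithin_symm hz _ _ _) u v w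

end IsMetricFamily

end TimeDependent

/-! ### Curve-shrinking flows in a coordinate domain -/

section Pullback

variable {E : Type*} [NormedAddCommGroup E] [NormedSpace ℝ E]

/-- The point of spacetime reached by `c`. -/
def graphMap (c : ℝ × ℝ → E) (q : ℝ × ℝ) : E × ℝ := (c q, q.2)

theorem contDiffOn_graphMap {s : Set (ℝ × ℝ)} {c : ℝ × ℝ → E} (hc : ContDiffOn ℝ ∞ c s) :
    ContDiffOn ℝ ∞ (graphMap c) s := hc.prodMk contDiff_snd.contDiffOn

theorem pd_graphMap {s : Set (ℝ × ℝ)} (hs : UniqueDiffOn ℝ s) {c : ℝ × ℝ → E}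
    (hc : ContDiffOn ℝ ∞ c s) {q : ℝ × ℝ} (hq : q ∈ s) (e : ℝ × ℝ) :
    pd s e (graphMap c) q = (pd s e c q, e.2) := by
  have : HasFDerivWithinAt (graphMap c)
      ((fderivWithin ℝ c s q).prod (ContinuousLinearMap.snd ℝ ℝ ℝ)) s q :=
    (hc.differentiableWithinAt_of_mem hq).hasFDerivWithinAt.prodMk hasFDerivWithinAt_snd
  simp only [pd, this.fderivWithin (hs q hq)]
  rfl

theorem pd_comp_graphMap {V : Type*} [NormedAddCommGroup V] [NormedSpace ℝ V]
    {s : Set (ℝ × ℝ)} (hs : UniqueDiffOn ℝ s) {c : ℝ × ℝ → E}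
    (hc : ContDiffOn ℝ ∞ c s) {U : Set (E × ℝ)} (hU : MapsTo (graphMap c) s U)
    {B : E × ℝ → V} (hB : ContDiffOn ℝ ∞ B U) {q : ℝ × ℝ} (hq : q ∈ s) (e : ℝ × ℝ) :
    pd s e (fun z => B (graphMap c z)) q
      = fderivWithin ℝ B U (graphMap c q) (pd s e c q, e.2) := by
  rw [← pd_graphMap hs hc hq]
  have := fderivWithin_comp (f := graphMap c) (g := B) q (hB.differentiableWithinAt_of_mem (hU hq))
    ((contDiffOn_graphMap hc).differentiableWithinAt_of_mem hq) hU (hs q hq)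
  simp only [pd]
  change fderivWithin ℝ (B ∘ graphMap c) s q e = _
  rw [this]
  rfl

variable [FiniteDimensional ℝ E]

/-- The connection form of the pullback connection in the direction `e`. -/
def connForm (s : Set (ℝ × ℝ)) (U : Set (E × ℝ)) (G : E × ℝ → E →L[ℝ] E →L[ℝ] ℝ)
    (c : ℝ × ℝ → E) (e : ℝ × ℝ) (q : ℝ × ℝ) : E →L[ℝ] E :=
  christoffelMap U G (graphMap c q) (pd s e c q)

/-- A curve-shrinking flow in a coordinate domain. -/
structure IsCoordFlow (s : Set (ℝ × ℝ)) (U : Set (E × ℝ)) (G : E × ℝ → E →L[ℝ] E →L[ℝ] ℝ)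
    (c : ℝ × ℝ → E) : Prop where
  metric : IsMetricFamily U G
  unique : UniqueDiffOn ℝ s
  closure : s ⊆ closure (interior s)
  smooth : ContDiffOn ℝ ∞ c s
  mapsTo : MapsTo (graphMap c) s U
  immersed : ∀ q ∈ s, pd s (1, 0) c q ≠ 0
  flow : ∀ q ∈ s, pd s (0, 1) c q =
    (len (fun q => G (graphMap c q)) (pd s (1, 0) c) q)⁻¹ •
      cov s (1, 0) (connForm s U G c (1, 0))
        (unitField (fun q => G (graphMap c q)) (pd s (1, 0) c)) q

namespace IsCoordFlow

variable {s : Set (ℝ × ℝ)} {U : Set (E × ℝ)} {G : E × ℝ → E →L[ℝ] E →L[ℝ] ℝ}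
  {c : ℝ × ℝ → E} {q : ℝ × ℝ}

theorem smooth_christoffel_comp (h : IsCoordFlow s U G c) :
    ContDiffOn ℝ ∞ (fun q => christoffelMap U G (graphMap c q)) s :=
  h.metric.smooth_christoffelMap.comp (contDiffOn_graphMap h.smooth) h.mapsTo

theorem smooth_connForm (h : IsCoordFlow s U G c) (e : ℝ × ℝ) :
    ContDiffOn ℝ ∞ (connForm s U G c e) s :=
  h.smooth_christoffel_comp.clm_apply (contDiffOn_pd h.unique h.smooth)

/-- Metric compatibility is that of Γ composed with the chain rule along (c,t), with Q as the
explicit time derivative. Torsion-freeness combines the symmetry of Γ with that of the mixed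
partials of c. -/
theorem pulledBackFlow (h : IsCoordFlow s U G c) :
    PulledBackFlow s (fun q => G (graphMap c q)) (fun q => timeDeriv U G (graphMap c q))
      (connForm s U G c (1, 0)) (connForm s U G c (0, 1)) (pd s (1, 0) c) (pd s (0, 1) c) where
  unique := h.unique
  closure := h.closure
  smooth_g := h.metric.smooth.comp (contDiffOn_graphMap h.smooth) h.mapsTo
  smooth_Ax := h.smooth_connForm _
  smooth_At := h.smooth_connForm _
  smooth_X := contDiffOn_pd h.unique h.smooth
  smooth_H := contDiffOn_pd h.unique h.smooth
  symm q hq := h.metric.symm _ (h.mapsTo hq)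
  pos q hq := h.metric.posDef _ (h.mapsTo hq) _ (h.immersed q hq)
  compat_x q hq v w := by
    rw [pd_comp_graphMap h.unique h.smooth h.mapsTo h.metric.smooth hq]
    exact h.metric.spaceDeriv_eq (h.mapsTo hq) _ _ _
  compat_t q hq v w := by
    rw [pd_comp_graphMap h.unique h.smooth h.mapsTo h.metric.smooth hq]
    have : (pd s (0, 1) c q, ((0, 1) : ℝ × ℝ).2) = ((0, 1) : E × ℝ) + (pd s (0, 1) c q, 0) := by
      simp
    rw [this, map_add, add_apply, add_apply, h.metric.spaceDeriv_eq (h.mapsTo hq), ← add_assoc]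
    rfl
  torsion q hq := by
    simp only [cov, connForm]
    rw [pd_comm h.unique h.closure h.smooth hq,
      h.metric.christoffelMap_symm (h.mapsTo hq) (pd s (1, 0) c q)]
  flow := h.flow

/-- The curvature of the pullback connection. -/
theorem bundleCurvature_eq (h : IsCoordFlow s U G c) (hq : q ∈ s) (v : E) :
    bundleCurvature s (connForm s U G c (1, 0)) (connForm s U G c (0, 1)) q v
      = fderivWithin ℝ (christoffelMap U G) U (graphMap c q) (pd s (0, 1) c q, 1)
          (pd s (1, 0) c q) v
        - fderivWithin ℝ (christoffelMap U G) U (graphMap c q) (pd s (1, 0) c q, 0)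
          (pd s (0, 1) c q) v
        + christoffelMap U G (graphMap c q) (pd s (0, 1) c q)
          (christoffelMap U G (graphMap c q) (pd s (1, 0) c q) v)
        - christoffelMap U G (graphMap c q) (pd s (1, 0) c q)
          (christoffelMap U G (graphMap c q) (pd s (0, 1) c q) v) := by
  have key : ∀ e e' : ℝ × ℝ, pd s e' (connForm s U G c e) q
      = fderivWithin ℝ (christoffelMap U G) U (graphMap c q) (pd s e' c q, e'.2) (pd s e c q)
        + christoffelMap U G (graphMap c q) (pd s e' (pd s e c) q) := by
    intro e e'
    rw [← pd_comp_graphMap h.unique h.smooth h.mapsTo h.metric.smooth_christoffelMap hq]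
    exact pd_clm_apply h.unique h.smooth_christoffel_comp (contDiffOn_pd h.unique h.smooth) hq
  -- The two terms in which Γ is applied to the mixed second derivative of c cancel.
  simp only [bundleCurvature, key, pd_comm h.unique h.closure h.smooth hq (0, 1) (1, 0)]
  simp only [connForm, add_apply]
  abel

end IsCoordFlow

/-- Uniform bounds for a metric family and its derivatives at a point. -/
structure MetricBound (C : ℝ) (U : Set (E × ℝ)) (G : E × ℝ → E →L[ℝ] E →L[ℝ] ℝ)
    (z : E × ℝ) : Prop where
  nonneg : 0 ≤ C
  norm_le : ∀ u, ‖u‖ ≤ C * Real.sqrt (G z u u)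
  metric_le : ‖G z‖ ≤ C
  time_le : ‖timeDeriv U G z‖ ≤ C
  christoffel_le : ‖christoffelMap U G z‖ ≤ C
  deriv_christoffel_le : ‖fderivWithin ℝ (christoffelMap U G) U z‖ ≤ C

theorem norm_bilin_le {V W : Type*} [NormedAddCommGroup V] [NormedSpace ℝ V]
    [NormedAddCommGroup W] [NormedSpace ℝ W] {B : V →L[ℝ] V →L[ℝ] W} {C a b : ℝ} {u v : V}
    (hC : 0 ≤ C) (hB : ‖B‖ ≤ C) (hu : ‖u‖ ≤ a) (hv : ‖v‖ ≤ b) : ‖B u v‖ ≤ C * a * b := by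
  have ha : 0 ≤ a := (norm_nonneg u).trans hu
  calc ‖B u v‖ ≤ ‖B‖ * ‖u‖ * ‖v‖ := B.le_opNorm₂ u v
    _ ≤ C * a * b := by gcongr

/-- The constant in the evolution inequality resulting from bounds by `C`. -/
def evolutionConst (C : ℝ) : ℝ := 3 * C ^ 3 + 2 * C ^ 5 + 5 * C ^ 6 + 4 * C ^ 7

/-! ### Estimates for the flow in one coordinate domain -/

namespace IsCoordFlow

variable {s : Set (ℝ × ℝ)} {U : Set (E × ℝ)} {G : E × ℝ → E →L[ℝ] E →L[ℝ] ℝ}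
  {c : ℝ × ℝ → E} {q : ℝ × ℝ}

theorem norm_unit_le (h : IsCoordFlow s U G c) (hq : q ∈ s) {C : ℝ}
    (hC : MetricBound C U G (graphMap c q)) :
    ‖unitField (fun q => G (graphMap c q)) (pd s (1, 0) c) q‖ ≤ C := by
  have h1 := hC.norm_le (unitField (fun q => G (graphMap c q)) (pd s (1, 0) c) q)
  rw [h.pulledBackFlow.inner_unit_unit hq] at h1
  simpa using h1

/-- The curvature is linear in X = |X| S, so the factor |X|⁻¹ cancels and only S and H remain. Every
term contains H except the time derivative of Γ, which supplies the summand C³ without a factor k.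
-/
theorem norm_curvature_le (h : IsCoordFlow s U G c) (hq : q ∈ s) {C k : ℝ}
    (hC : MetricBound C U G (graphMap c q)) (hk : ‖pd s (0, 1) c q‖ ≤ C * k) (hk0 : 0 ≤ k) :
    ‖(len (fun q => G (graphMap c q)) (pd s (1, 0) c) q)⁻¹ •
        bundleCurvature s (connForm s U G c (1, 0)) (connForm s U G c (0, 1)) q
          (unitField (fun q => G (graphMap c q)) (pd s (1, 0) c) q)‖
      ≤ C ^ 3 * (C * k + 1) + C ^ 4 * k + 2 * C ^ 5 * k := by
  set S := unitField (fun q => G (graphMap c q)) (pd s (1, 0) c) q with hS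
  set H := pd s (0, 1) c q with hH
  set Γ := christoffelMap U G (graphMap c q) with hΓ
  set D := fderivWithin ℝ (christoffelMap U G) U (graphMap c q) with hD
  have h0 := hC.nonneg
  have hl := h.pulledBackFlow.len_pos hq
  have hSn : ‖S‖ ≤ C := h.norm_unit_le hq hC
  set l := len (fun q => G (graphMap c q)) (pd s (1, 0) c) q with hldef
  have hX : pd s (1, 0) c q = l • S := h.pulledBackFlow.X_eq hq
  have e1 : l⁻¹ • bundleCurvature s (connForm s U G c (1, 0)) (connForm s U G c (0, 1)) q S
      = D (H, 1) S S - D (S, 0) H S + Γ H (Γ S S) - Γ S (Γ H S) := by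
    rw [h.bundleCurvature_eq hq, hX]
    have : ((l • S, 0) : E × ℝ) = l • (S, 0) := by simp
    rw [this]
    simp only [map_smul, smul_apply, ← hH, ← hΓ, ← hD, ← smul_sub, ← smul_add, smul_smul,
      inv_mul_cancel₀ hl.ne', one_smul]
  rw [e1]
  have hΓn : ‖Γ‖ ≤ C := hC.christoffel_le
  have hDn : ∀ w : E × ℝ, ∀ a, ‖w‖ ≤ a → ‖D w‖ ≤ C * a := fun w a hw =>
    (D.le_opNorm w).trans (mul_le_mul hC.deriv_christoffel_le hw (norm_nonneg _) h0)
  have hH1 : ‖((H, 1) : E × ℝ)‖ ≤ C * k + 1 := by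
    rw [Prod.norm_mk]
    have : 0 ≤ C * k := by positivity
    exact max_le (by linarith) (by rw [norm_one]; linarith)
  have hS1 : ‖((S, 0) : E × ℝ)‖ ≤ C := by
    rw [Prod.norm_mk, norm_zero]
    exact max_le hSn h0
  have t1 := norm_bilin_le (by positivity) (hDn _ _ hH1) hSn hSn
  have t2 := norm_bilin_le (by positivity) (hDn _ _ hS1) hk hSn
  have t3 := norm_bilin_le h0 hΓn hk (norm_bilin_le h0 hΓn hSn hSn)
  have t4 := norm_bilin_le h0 hΓn hSn (norm_bilin_le h0 hΓn hk hSn)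
  calc _ ≤ ‖D (H, 1) S S‖ + ‖D (S, 0) H S‖ + ‖Γ H (Γ S S)‖ + ‖Γ S (Γ H S)‖ :=
        (norm_sub_le _ _).trans (add_le_add_left ((norm_add_le _ _).trans
          (add_le_add_left (norm_sub_le _ _) _)) _)
    _ ≤ _ := by
      refine (add_le_add (add_le_add (add_le_add t1 t2) t3) t4).trans (le_of_eq ?_)
      ring

/-- The component of `∇_S H` orthogonal to the curve. -/
def perpDerivH (s : Set (ℝ × ℝ)) (U : Set (E × ℝ)) (G : E × ℝ → E →L[ℝ] E →L[ℝ] ℝ)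
    (c : ℝ × ℝ → E) (q : ℝ × ℝ) : E :=
  let g := fun q => G (graphMap c q)
  let S := unitField g (pd s (1, 0) c) q
  let W := (len g (pd s (1, 0) c) q)⁻¹ •
    cov s (1, 0) (connForm s U G c (1, 0)) (pd s (0, 1) c) q
  W - g q W S • S

/-- Since `⟨∇_S H, S⟩ = -k²`, the orthogonal component satisfies `|(∇_S H)^⊥|² = |∇_S H|² - k⁴`. -/
theorem normSq_perpDerivH (h : IsCoordFlow s U G c) (hq : q ∈ s) :
    G (graphMap c q) (perpDerivH s U G c q) (perpDerivH s U G c q)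
      = G (graphMap c q) ((len (fun q => G (graphMap c q)) (pd s (1, 0) c) q)⁻¹ •
          cov s (1, 0) (connForm s U G c (1, 0)) (pd s (0, 1) c) q)
          ((len (fun q => G (graphMap c q)) (pd s (1, 0) c) q)⁻¹ •
            cov s (1, 0) (connForm s U G c (1, 0)) (pd s (0, 1) c) q)
        - G (graphMap c q) (pd s (0, 1) c q) (pd s (0, 1) c q) ^ 2 := by
  have hp := h.pulledBackFlow
  have hl := hp.len_pos hq
  have h1 := hp.inner_cov_H_unit hq
  have h2 := hp.inner_unit_unit hq
  have hsy := h.metric.symm _ (h.mapsTo hq)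
  set S := unitField (fun q => G (graphMap c q)) (pd s (1, 0) c) q with hS
  set W := (len (fun q => G (graphMap c q)) (pd s (1, 0) c) q)⁻¹ •
    cov s (1, 0) (connForm s U G c (1, 0)) (pd s (0, 1) c) q with hW
  have h3 : G (graphMap c q) W S = - G (graphMap c q) (pd s (0, 1) c q) (pd s (0, 1) c q) := by
    rw [hW, map_smul, smul_apply, h1, smul_eq_mul]
    field_simp
  have h4 : perpDerivH s U G c q = W - G (graphMap c q) W S • S := rfl
  rw [h4]
  simp only [map_sub, map_smul, sub_apply, smul_apply, smul_eq_mul, hsy S W, h2, h3]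
  ring

/-- The evolution inequality for `k²` in a coordinate domain. -/
theorem pd_t_normSq_H_le (h : IsCoordFlow s U G c) (hq : q ∈ s) {C : ℝ}
    (hC : MetricBound C U G (graphMap c q)) :
    pd s (0, 1) (fun q => G (graphMap c q) (pd s (0, 1) c q) (pd s (0, 1) c q)) q
      ≤ (len (fun q => G (graphMap c q)) (pd s (1, 0) c) q)⁻¹ *
          pd s (1, 0) (fun q => (len (fun q => G (graphMap c q)) (pd s (1, 0) c) q)⁻¹ *
            pd s (1, 0) (fun q => G (graphMap c q) (pd s (0, 1) c q) (pd s (0, 1) c q)) q) q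
        - 2 * (G (graphMap c q) (perpDerivH s U G c q) (perpDerivH s U G c q)
          + (1 / 4) * timeDeriv U G (graphMap c q)
            (unitField (fun q => G (graphMap c q)) (pd s (1, 0) c) q) (pd s (0, 1) c q) ^ 2)
        + 2 * G (graphMap c q) (pd s (0, 1) c q) (pd s (0, 1) c q) ^ 2
        + evolutionConst C * (G (graphMap c q) (pd s (0, 1) c q) (pd s (0, 1) c q)
          + Real.sqrt (G (graphMap c q) (pd s (0, 1) c q) (pd s (0, 1) c q))) := by
  have hk0 : 0 ≤ G (graphMap c q) (pd s (0, 1) c q) (pd s (0, 1) c q) :=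
    (h.metric.posDef _ (h.mapsTo hq)).nonneg _
  have hkH := hC.norm_le (pd s (0, 1) c q)
  have hSn := h.norm_unit_le hq hC
  have hF := h.norm_curvature_le hq hC hkH (Real.sqrt_nonneg _)
  have h0 := hC.nonneg
  rw [h.pulledBackFlow.pd_t_normSq_H hq, h.normSq_perpDerivH hq]
  set k := Real.sqrt (G (graphMap c q) (pd s (0, 1) c q) (pd s (0, 1) c q)) with hk
  have hks : G (graphMap c q) (pd s (0, 1) c q) (pd s (0, 1) c q) = k ^ 2 := (Real.sq_sqrt hk0).symm
  have hk' : 0 ≤ k := Real.sqrt_nonneg _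
  have t1 := (le_abs_self _).trans (norm_bilin_le h0 hC.time_le hkH hkH)
  have t2 := (neg_le_abs _).trans (norm_bilin_le h0 hC.time_le hSn hSn)
  have t3 := (le_abs_self _).trans (norm_bilin_le h0 hC.metric_le hF hkH)
  have t4 := norm_bilin_le h0 hC.time_le hSn hkH
  rw [Real.norm_eq_abs] at t4
  have t5 := sq_le_sq' (abs_le.1 t4).1 (abs_le.1 t4).2
  have t6 := mul_le_mul_of_nonneg_right t2 (sq_nonneg k)
  rw [hks]
  simp only [evolutionConst]
  have p1 : 0 ≤ C ^ 3 * k := by positivity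
  have p2 : 0 ≤ C ^ 6 * k := by positivity
  have p3 : 0 ≤ C ^ 7 * k := by positivity
  have p4 : 0 ≤ C ^ 5 * k ^ 2 := by positivity
  have p5 : 0 ≤ C ^ 6 * k ^ 2 := by positivity
  -- The estimates add up to (3C³ + 9C⁶/2 + 4C⁷)k² + 2C⁵k; the nonnegative terms p1 to p5 fill the
  -- gap to one constant times k² + k.
  nlinarith [t1, t3, t5, t6, p1, p2, p3, p4, p5]

/-- A Kato-type inequality: (k²)' = 2⟨DH,H⟩, and since H ⊥ S only the orthogonal part of DH
contributes, to which Cauchy–Schwarz applies. -/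
theorem pd_x_normSq_H_sq_le (h : IsCoordFlow s U G c) (hq : q ∈ s) :
    ((len (fun q => G (graphMap c q)) (pd s (1, 0) c) q)⁻¹ *
        pd s (1, 0) (fun q => G (graphMap c q) (pd s (0, 1) c q) (pd s (0, 1) c q)) q) ^ 2
      ≤ 4 * G (graphMap c q) (perpDerivH s U G c q) (perpDerivH s U G c q) *
        G (graphMap c q) (pd s (0, 1) c q) (pd s (0, 1) c q) := by
  have hp := h.pulledBackFlow
  have hcs := (h.metric.posDef _ (h.mapsTo hq)).inner_sq_le (h.metric.symm _ (h.mapsTo hq))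
    (perpDerivH s U G c q) (pd s (0, 1) c q)
  have h1 : G (graphMap c q) (unitField (fun q => G (graphMap c q)) (pd s (1, 0) c) q)
      (pd s (0, 1) c q) = 0 := by
    rw [h.metric.symm _ (h.mapsTo hq)]
    exact hp.inner_H_unit hq
  have h2 : G (graphMap c q) (perpDerivH s U G c q) (pd s (0, 1) c q)
      = (len (fun q => G (graphMap c q)) (pd s (1, 0) c) q)⁻¹ *
        G (graphMap c q) (cov s (1, 0) (connForm s U G c (1, 0)) (pd s (0, 1) c) q)
          (pd s (0, 1) c q) := by
    simp only [perpDerivH, map_sub, map_smul, sub_apply, smul_apply, smul_eq_mul, h1]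
    ring
  rw [h2] at hcs
  rw [hp.pd_x_normSq_H hq]
  linarith

end IsCoordFlow

end Pullback

/-! ### Slices of a product domain -/

section Slices

variable {V : Type*} [NormedAddCommGroup V] [NormedSpace ℝ V]

/-- For s relatively open in ℝ × I, horizontal slices are open, so x-derivatives are ordinary
derivatives, while time derivatives remain relative to I. This links `pd` with `deriv` and
`derivWithin` in the theorem. -/
theorem pd_hasDerivAt_fst {I : Set ℝ} {O s : Set (ℝ × ℝ)} (hO : IsOpen O)
    (hs : s = (univ ×ˢ I) ∩ O) {f : ℝ × ℝ → V} (hf : ContDiffOn ℝ ∞ f s) {x t : ℝ}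
    (hq : (x, t) ∈ s) : HasDerivAt (fun ξ => f (ξ, t)) (pd s (1, 0) f (x, t)) x := by
  have h1 := (hf.differentiableWithinAt_of_mem hq).hasFDerivWithinAt
  have h2 : HasDerivAt (fun ξ : ℝ => ((ξ, t) : ℝ × ℝ)) (1, 0) x :=
    (hasDerivAt_id x).prodMk (hasDerivAt_const x t)
  have h3 : MapsTo (fun ξ : ℝ => ((ξ, t) : ℝ × ℝ)) ((fun ξ : ℝ => ((ξ, t) : ℝ × ℝ)) ⁻¹' O) s := by
    intro ξ hξ
    rw [hs] at hq ⊢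
    exact ⟨⟨mem_univ _, hq.1.2⟩, hξ⟩
  have hm : (fun ξ : ℝ => ((ξ, t) : ℝ × ℝ)) ⁻¹' O ∈ nhds x := by
    rw [hs] at hq
    exact (hO.preimage (by fun_prop)).mem_nhds hq.2
  exact (HasFDerivWithinAt.comp_hasDerivWithinAt x h1 h2.hasDerivWithinAt h3).hasDerivAt hm

theorem pd_hasDerivWithinAt_snd {I : Set ℝ} {O s : Set (ℝ × ℝ)} (hO : IsOpen O)
    (hs : s = (univ ×ˢ I) ∩ O) {f : ℝ × ℝ → V} (hf : ContDiffOn ℝ ∞ f s) {x t : ℝ}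
    (hq : (x, t) ∈ s) : HasDerivWithinAt (fun τ => f (x, τ)) (pd s (0, 1) f (x, t)) I t := by
  have h1 := (hf.differentiableWithinAt_of_mem hq).hasFDerivWithinAt
  have h2 : HasDerivAt (fun τ : ℝ => ((x, τ) : ℝ × ℝ)) (0, 1) t :=
    (hasDerivAt_const t x).prodMk (hasDerivAt_id t)
  have h3 : MapsTo (fun τ : ℝ => ((x, τ) : ℝ × ℝ))
      (I ∩ (fun τ : ℝ => ((x, τ) : ℝ × ℝ)) ⁻¹' O) s := by
    intro τ hτ
    rw [hs]
    exact ⟨⟨mem_univ _, hτ.1⟩, hτ.2⟩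
  have hm : (fun τ : ℝ => ((x, τ) : ℝ × ℝ)) ⁻¹' O ∈ nhds t := by
    rw [hs] at hq
    exact (hO.preimage (by fun_prop)).mem_nhds hq.2
  exact (hasDerivWithinAt_inter hm).1
    (HasFDerivWithinAt.comp_hasDerivWithinAt t h1 h2.hasDerivWithinAt h3)

end Slices

/-! ### The metric g(t) + dt² and its Christoffel symbols -/

section Spacetime

variable {E : Type*} [NormedAddCommGroup E] [NormedSpace ℝ E]

theorem fderivWithin_slice {V : Type*} [NormedAddCommGroup V] [NormedSpace ℝ V] {W : Set E}
    (hW : UniqueDiffOn ℝ W) {I : Set ℝ} {G : E × ℝ → V} {y : E} {t : ℝ} (hy : y ∈ W) (ht : t ∈ I)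
    (hG : ContDiffOn ℝ ∞ G (W ×ˢ I)) :
    fderivWithin ℝ (fun y => G (y, t)) W y
      = (fderivWithin ℝ G (W ×ˢ I) (y, t)).comp (ContinuousLinearMap.inl ℝ E ℝ) := by
  have h1 := (hG.differentiableWithinAt_of_mem (q := (y, t)) ⟨hy, ht⟩).hasFDerivWithinAt
  have h2 : HasFDerivWithinAt (fun y : E => ((y, t) : E × ℝ)) (ContinuousLinearMap.inl ℝ E ℝ) W y :=
    (hasFDerivWithinAt_id y W).prodMk (hasFDerivWithinAt_const t y W)
  exact (h1.comp y h2 (fun z (hz : z ∈ W) => show (z, t) ∈ W ×ˢ I from ⟨hz, ht⟩)).fderivWithin (hW y hy)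

/-- The orthogonal sum of `B` and the standard metric of `ℝ`. -/
def productMetric (B : E →L[ℝ] E →L[ℝ] ℝ) : E × ℝ →L[ℝ] E × ℝ →L[ℝ] ℝ :=
  B.bilinearComp (ContinuousLinearMap.fst ℝ E ℝ) (ContinuousLinearMap.fst ℝ E ℝ)
    + (ContinuousLinearMap.mul ℝ ℝ).bilinearComp
      (ContinuousLinearMap.snd ℝ E ℝ) (ContinuousLinearMap.snd ℝ E ℝ)

theorem productMetric_apply (B : E →L[ℝ] E →L[ℝ] ℝ) (a b : E × ℝ) :
    productMetric B a b = B a.1 b.1 + a.2 * b.2 := rfl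

theorem IsPosDef.productMetric {B : E →L[ℝ] E →L[ℝ] ℝ} (hB : IsPosDef B) :
    IsPosDef (productMetric B) := by
  intro a ha
  rw [productMetric_apply]
  rcases eq_or_ne a.1 0 with h | h
  · have : a.2 ≠ 0 := fun h' => ha (Prod.ext h h')
    rw [h]
    simpa using mul_self_pos.2 this
  · exact add_pos_of_pos_of_nonneg (hB _ h) (mul_self_nonneg _)

variable [FiniteDimensional ℝ E]

theorem fderivWithin_productMetric {U : Set (E × ℝ)} {G : E × ℝ → E →L[ℝ] E →L[ℝ] ℝ}
    (h : IsMetricFamily U G) {z : E × ℝ} (hz : z ∈ U) (w a b : E × ℝ) :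
    fderivWithin ℝ (fun z => productMetric (G z)) U z w a b
      = fderivWithin ℝ G U z w a.1 b.1 := by
  have h0 : ∀ a b : E × ℝ,
      DifferentiableWithinAt ℝ (fun z => G z a.1 b.1 + a.2 * b.2) U z := fun a b =>
    (((h.smooth.differentiableWithinAt_of_mem hz).clm_apply (differentiableWithinAt_const _)).clm_apply
      (differentiableWithinAt_const _)).add_const _
  have h1 : ContDiffOn ℝ ∞ (fun z => productMetric (G z)) U := by
    refine contDiffOn_clm_apply.2 fun a => contDiffOn_clm_apply.2 fun b => ?_
    exact ((h.smooth.clm_apply contDiffOn_const).clm_apply contDiffOn_const).add contDiffOn_const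
  rw [← fderivWithin_apply_apply (h.unique z hz) (h1.differentiableWithinAt_of_mem hz),
    ← fderivWithin_apply_apply (h.unique z hz) (h.smooth.differentiableWithinAt_of_mem hz)]
  change fderivWithin ℝ (fun z => G z a.1 b.1 + a.2 * b.2) U z w = _
  rw [fderivWithin_add_const]

/-- The Christoffel symbols of the spacetime metric `g(t) + dt²` on spatial vectors. -/
theorem christoffel_productMetric {U : Set (E × ℝ)} {G : E × ℝ → E →L[ℝ] E →L[ℝ] ℝ}
    (h : IsMetricFamily U G) {z : E × ℝ} (hz : z ∈ U) (u v : E) :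
    christoffel U (fun z => productMetric (G z)) z (u, 0) (v, 0)
      = (christoffelMap U G z u v, -(1 / 2) * timeDeriv U G z u v) := by
  rw [christoffel_eq]
  refine christoffelForm_eq_of_inner (h.posDef z hz).productMetric fun w => ?_
  simp only [fderivWithin_productMetric h hz, productMetric_apply]
  rw [christoffelMap, christoffelForm_inner (h.posDef z hz)]
  -- Only the Koszul term -∂_w g(u,v) sees the time component of w, which gives the time component
  -- -½ ∂_t g(u,v) of the symbol.
  have h1 : fderivWithin ℝ G U z w u v
      = fderivWithin ℝ G U z (w.1, 0) u v + w.2 * timeDeriv U G z u v := by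
    have : w = (w.1, (0 : ℝ)) + w.2 • ((0 : E), (1 : ℝ)) := by simp
    conv_lhs => rw [this]
    simp only [map_add, map_smul, add_apply, smul_apply, smul_eq_mul, timeDeriv]
  rw [h1]
  simp only [spaceDeriv, ContinuousLinearMap.comp_apply, ContinuousLinearMap.inl_apply]
  ring

end Spacetime

/-! ### Metrics in charts -/

section Charts

variable {E : Type*} [NormedAddCommGroup E] [NormedSpace ℝ E]
  {M : Type*} [TopologicalSpace M] [ChartedSpace E M]

theorem isOpen_chartDomain (p : M) : IsOpen (chartDomain E p) := isOpen_extChartAt_target p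

/-- The derivative of the inverse chart. -/
def chartDeriv (E : Type*) [NormedAddCommGroup E] [NormedSpace ℝ E]
    {M : Type*} [TopologicalSpace M] [ChartedSpace E M] (p : M) (y : E) : E →L[ℝ] E :=
  mfderiv 𝓘(ℝ, E) 𝓘(ℝ, E) (extChartAt 𝓘(ℝ, E) p).symm y

/-- The change of coordinates from the chart around `p` to the chart around `p'`. -/
def transition (E : Type*) [NormedAddCommGroup E] [NormedSpace ℝ E]
    {M : Type*} [TopologicalSpace M] [ChartedSpace E M] (p p' : M) (y : E) : E :=
  extChartAt 𝓘(ℝ, E) p' ((extChartAt 𝓘(ℝ, E) p).symm y)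

/-- The domain of the change of coordinates. -/
def transitionDomain (E : Type*) [NormedAddCommGroup E] [NormedSpace ℝ E]
    {M : Type*} [TopologicalSpace M] [ChartedSpace E M] (p p' : M) : Set E :=
  chartDomain E p ∩ (extChartAt 𝓘(ℝ, E) p).symm ⁻¹' (extChartAt 𝓘(ℝ, E) p').source

theorem isOpen_transitionDomain (p p' : M) : IsOpen (transitionDomain E p p') :=
  (continuousOn_extChartAt_symm p).isOpen_inter_preimage (isOpen_chartDomain p)
    (isOpen_extChartAt_source p')

theorem transition_mem {p p' : M} {y : E} (hy : y ∈ transitionDomain E p p') :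
    transition E p p' y ∈ chartDomain E p' := (extChartAt 𝓘(ℝ, E) p').map_source hy.2

theorem symm_transition {p p' : M} {y : E} (hy : y ∈ transitionDomain E p p') :
    (extChartAt 𝓘(ℝ, E) p').symm (transition E p p' y) = (extChartAt 𝓘(ℝ, E) p).symm y :=
  (extChartAt 𝓘(ℝ, E) p').left_inv hy.2

variable [IsManifold 𝓘(ℝ, E) ∞ M]

theorem one_le_infty : (1 : ℕ∞ω) ≤ ∞ := by
  change ((1 : ℕ∞) : ℕ∞ω) ≤ _
  exact WithTop.coe_le_coe.2 le_top

theorem contDiffAt_transition {p p' : M} {y : E} (hy : y ∈ transitionDomain E p p') :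
    ContDiffAt ℝ ∞ (transition E p p') y := by
  have h := contDiffWithinAt_ext_coord_change (I := 𝓘(ℝ, E)) (n := ∞) p' p (y := y) hy
  rwa [modelWithCornersSelf_coe, range_id, contDiffWithinAt_univ] at h

theorem mdifferentiableAt_chart_symm {p : M} {y : E} (hy : y ∈ chartDomain E p) :
    MDifferentiableAt 𝓘(ℝ, E) 𝓘(ℝ, E) (extChartAt 𝓘(ℝ, E) p).symm y := by
  have : IsManifold 𝓘(ℝ, E) 1 M := IsManifold.of_le one_le_infty
  have := mdifferentiableWithinAt_extChartAt_symm (I := 𝓘(ℝ, E)) hy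
  simpa [mdifferentiableWithinAt_univ] using this

theorem bijective_chartDeriv {p : M} {y : E} (hy : y ∈ chartDomain E p) :
    Function.Bijective (chartDeriv E p y) := by
  have : IsManifold 𝓘(ℝ, E) 1 M := IsManifold.of_le one_le_infty
  have := isInvertible_mfderivWithin_extChartAt_symm (I := 𝓘(ℝ, E)) hy
  rw [modelWithCornersSelf_coe, range_id, mfderivWithin_univ] at this
  exact this.bijective

/-- The chain rule for the factorization of one inverse chart through the transition map and the
other inverse chart. -/
theorem chartDeriv_transition {p p' : M} {y : E} (hy : y ∈ transitionDomain E p p') (u : E) :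
    chartDeriv E p' (transition E p p' y) (fderiv ℝ (transition E p p') y u)
      = chartDeriv E p y u := by
  have h1 : (extChartAt 𝓘(ℝ, E) p).symm =ᶠ[nhds y]
      (extChartAt 𝓘(ℝ, E) p').symm ∘ transition E p p' := by
    filter_upwards [(isOpen_transitionDomain p p').mem_nhds hy] with z hz
    exact (symm_transition hz).symm
  have h2 := mfderiv_comp (I := 𝓘(ℝ, E)) (I' := 𝓘(ℝ, E)) (I'' := 𝓘(ℝ, E)) y
    (mdifferentiableAt_chart_symm (transition_mem hy))
    ((contDiffAt_transition hy).differentiableAt (by simp)).mdifferentiableAt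
  have h3 := h1.mfderiv_eq (I := 𝓘(ℝ, E)) (I' := 𝓘(ℝ, E))
  rw [mfderiv_eq_fderiv] at h2
  exact (DFunLike.congr_fun (h3.trans h2) u).symm

theorem surjective_fderiv_transition {p p' : M} {y : E} (hy : y ∈ transitionDomain E p p') :
    Function.Surjective (fderiv ℝ (transition E p p') y) := by
  intro w
  obtain ⟨u, hu⟩ := (bijective_chartDeriv (E := E) hy.1).2
    (chartDeriv E p' (transition E p p' y) w)
  refine ⟨u, (bijective_chartDeriv (E := E) (transition_mem hy)).1 ?_⟩
  rw [chartDeriv_transition hy, hu]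

/-- The metric at a point, as a bilinear form on the model space. -/
def metricAt (g : SmoothMetric E M) (m : M) : E →L[ℝ] E →L[ℝ] ℝ := g.inner m

theorem isPosDef_metricAt (g : SmoothMetric E M) (m : M) :
    IsPosDef (metricAt g m) := fun v hv => g.pos m v hv

theorem metricAt_symm (g : SmoothMetric E M) (m : M) (u v : E) :
    metricAt g m u v = metricAt g m v u := g.symm m u v

theorem coordMetric_apply (g : SmoothMetric E M) (p : M) (y u v : E) :
    coordMetric g p y u v
      = metricAt g ((extChartAt 𝓘(ℝ, E) p).symm y) (chartDeriv E p y u) (chartDeriv E p y v) := rfl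

theorem coordMetric_transition (g : SmoothMetric E M) {p p' : M} {y : E}
    (hy : y ∈ transitionDomain E p p') (u v : E) :
    coordMetric g p y u v = coordMetric g p' (transition E p p' y)
      (fderiv ℝ (transition E p p') y u) (fderiv ℝ (transition E p p') y v) := by
  rw [coordMetric_apply, coordMetric_apply, chartDeriv_transition hy, chartDeriv_transition hy,
    symm_transition hy]

/-- The family of metrics `g(t)` in the chart around `p`. -/
def chartMetric (g : ℝ → SmoothMetric E M) (p : M) (z : E × ℝ) : E →L[ℝ] E →L[ℝ] ℝ :=
  coordMetric (g z.2) p z.1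

theorem isMetricFamily_chartMetric [FiniteDimensional ℝ E] {T : ℝ} (hT : 0 < T)
    {g : ℝ → SmoothMetric E M} (hg : IsRicciFlow T g) (p : M) :
    IsMetricFamily (chartDomain E p ×ˢ Icc 0 T) (chartMetric g p) where
  unique := (isOpen_chartDomain p).uniqueDiffOn.prod (uniqueDiffOn_Icc hT)
  smooth := hg.smooth p
  symm z _ u v := by
    simp only [chartMetric, coordMetric_apply]
    exact metricAt_symm _ _ _ _
  posDef z hz u hu := by
    simp only [chartMetric, coordMetric_apply]
    exact isPosDef_metricAt _ _ _ fun h0 => hu <|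
      (bijective_chartDeriv (E := E) hz.1).1 (h0.trans (map_zero (chartDeriv E p z.1)).symm)

end Charts

/-! ### Curve-shrinking flows in charts -/

section Curves

variable {E : Type*} [NormedAddCommGroup E] [NormedSpace ℝ E]
  {M : Type*} [TopologicalSpace M] [ChartedSpace E M]

/-- The parameters of the points of the curves in the domain of the chart around `p`. -/
def curveDomain (E : Type*) [NormedAddCommGroup E] [NormedSpace ℝ E]
    {M : Type*} [TopologicalSpace M] [ChartedSpace E M] (T : ℝ) (c : Circle → ℝ → M) (p : M) :
    Set (ℝ × ℝ) :=
  {q | q.2 ∈ Icc 0 T ∧ c (Circle.exp q.1) q.2 ∈ (chartAt E p).source}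

/-- The family of curves in the chart around `p`. -/
def chartCurve (E : Type*) [NormedAddCommGroup E] [NormedSpace ℝ E]
    {M : Type*} [TopologicalSpace M] [ChartedSpace E M] (c : Circle → ℝ → M) (p : M)
    (q : ℝ × ℝ) : E :=
  coordCurve E c p q.2 q.1

theorem mem_curveDomain_self {T : ℝ} {c : Circle → ℝ → M} {x t : ℝ} (ht : t ∈ Icc 0 T) :
    (x, t) ∈ curveDomain E T c (c (Circle.exp x) t) := ⟨ht, mem_chart_source E _⟩

theorem chartCurve_mem {T : ℝ} {c : Circle → ℝ → M} {p : M} {q : ℝ × ℝ}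
    (hq : q ∈ curveDomain E T c p) : chartCurve E c p q ∈ chartDomain E p :=
  (extChartAt 𝓘(ℝ, E) p).map_source (by rw [extChartAt_source]; exact hq.2)

theorem symm_chartCurve {T : ℝ} {c : Circle → ℝ → M} {p : M} {q : ℝ × ℝ}
    (hq : q ∈ curveDomain E T c p) :
    (extChartAt 𝓘(ℝ, E) p).symm (chartCurve E c p q) = c (Circle.exp q.1) q.2 :=
  (extChartAt 𝓘(ℝ, E) p).left_inv (by rw [extChartAt_source]; exact hq.2)

theorem chartCurve_mem_transitionDomain {T : ℝ} {c : Circle → ℝ → M} {p p' : M} {q : ℝ × ℝ}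
    (hq : q ∈ curveDomain E T c p) (hq' : q ∈ curveDomain E T c p') :
    chartCurve E c p q ∈ transitionDomain E p p' := by
  refine ⟨chartCurve_mem hq, ?_⟩
  rw [mem_preimage, symm_chartCurve hq, extChartAt_source]
  exact hq'.2

theorem transition_chartCurve {T : ℝ} {c : Circle → ℝ → M} {p p' : M} {q : ℝ × ℝ}
    (hq : q ∈ curveDomain E T c p) :
    transition E p p' (chartCurve E c p q) = chartCurve E c p' q := by
  rw [transition, symm_chartCurve hq]
  rfl

variable [IsManifold 𝓘(ℝ, E) ∞ M]

/-- Smoothness of a family of curves in terms of the angular coordinate. -/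
def IsSmoothFamily (E : Type*) [NormedAddCommGroup E] [NormedSpace ℝ E]
    {M : Type*} [TopologicalSpace M] [ChartedSpace E M] (T : ℝ) (c : Circle → ℝ → M) : Prop :=
  ContMDiffOn ((𝓡 1).prod 𝓘(ℝ, ℝ)) 𝓘(ℝ, E) ∞ (fun q : Circle × ℝ => c q.1 q.2) (univ ×ˢ Icc 0 T)

omit [IsManifold 𝓘(ℝ, E) ∞ M] in
theorem contMDiffOn_lift {T : ℝ} {c : Circle → ℝ → M} (hc : IsSmoothFamily E T c) :
    ContMDiffOn 𝓘(ℝ, ℝ × ℝ) 𝓘(ℝ, E) ∞ (fun q : ℝ × ℝ => c (Circle.exp q.1) q.2)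
      (univ ×ˢ Icc 0 T) := by
  have h1 : ContMDiff 𝓘(ℝ, ℝ × ℝ) 𝓘(ℝ, ℝ) ∞ (Prod.fst : ℝ × ℝ → ℝ) := contDiff_fst.contMDiff
  have h2 : ContMDiff 𝓘(ℝ, ℝ × ℝ) 𝓘(ℝ, ℝ) ∞ (Prod.snd : ℝ × ℝ → ℝ) := contDiff_snd.contMDiff
  have h3 : ContMDiff 𝓘(ℝ, ℝ × ℝ) ((𝓡 1).prod 𝓘(ℝ, ℝ)) ∞
      (fun q : ℝ × ℝ => (Circle.exp q.1, q.2)) := (contMDiff_circleExp.comp h1).prodMk h2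
  exact ContMDiffOn.comp hc h3.contMDiffOn fun q hq => ⟨mem_univ _, hq.2⟩

-- Relative openness in ℝ × [0,T] is what makes slices, unique differentiability and the behaviour
-- at t = 0, T accessible.
omit [IsManifold 𝓘(ℝ, E) ∞ M] in
theorem exists_isOpen_curveDomain {T : ℝ} {c : Circle → ℝ → M} (hc : IsSmoothFamily E T c) (p : M) :
    ∃ O : Set (ℝ × ℝ), IsOpen O ∧ curveDomain E T c p = (univ ×ˢ Icc 0 T) ∩ O := by
  obtain ⟨O, hO, h⟩ := continuousOn_iff'.1 (contMDiffOn_lift hc).continuousOn _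
    (chartAt E p).open_source
  refine ⟨O, hO, ?_⟩
  rw [inter_comm, ← h]
  ext q
  simp [curveDomain, and_comm]

omit [IsManifold 𝓘(ℝ, E) ∞ M] in
theorem uniqueDiffOn_curveDomain {T : ℝ} (hT : 0 < T) {c : Circle → ℝ → M}
    (hc : IsSmoothFamily E T c) (p : M) : UniqueDiffOn ℝ (curveDomain E T c p) := by
  obtain ⟨O, hO, h⟩ := exists_isOpen_curveDomain hc p
  rw [h]
  exact (uniqueDiffOn_univ.prod (uniqueDiffOn_Icc hT)).inter hO

omit [IsManifold 𝓘(ℝ, E) ∞ M] in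
theorem curveDomain_subset_closure {T : ℝ} (hT : 0 < T) {c : Circle → ℝ → M}
    (hc : IsSmoothFamily E T c) (p : M) :
    curveDomain E T c p ⊆ closure (interior (curveDomain E T c p)) := by
  obtain ⟨O, hO, h⟩ := exists_isOpen_curveDomain hc p
  rw [h, interior_inter, hO.interior_eq, interior_prod_eq, interior_univ, interior_Icc]
  rintro q ⟨hq, hqO⟩
  have h2 : q ∈ closure ((univ : Set ℝ) ×ˢ Ioo 0 T) := by
    rw [closure_prod_eq, closure_univ, closure_Ioo hT.ne]
    exact hq
  have := hO.inter_closure ⟨hqO, h2⟩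
  rwa [inter_comm] at this

theorem contDiffOn_chartCurve {T : ℝ} {c : Circle → ℝ → M} (hc : IsSmoothFamily E T c) (p : M) :
    ContDiffOn ℝ ∞ (chartCurve E c p) (curveDomain E T c p) := by
  have h1 : ContMDiffOn 𝓘(ℝ, E) 𝓘(ℝ, E) ∞ (extChartAt 𝓘(ℝ, E) p) (chartAt E p).source :=
    contMDiffOn_extChartAt
  exact (h1.comp ((contMDiffOn_lift hc).mono fun q hq => ⟨mem_univ _, hq.1⟩)
    fun q hq => hq.2).contDiffOn

theorem hasDerivAt_chartCurve {T : ℝ} {c : Circle → ℝ → M} (hc : IsSmoothFamily E T c) {p : M}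
    {x t : ℝ} (hq : (x, t) ∈ curveDomain E T c p) :
    HasDerivAt (coordCurve E c p t)
      (pd (curveDomain E T c p) (1, 0) (chartCurve E c p) (x, t)) x := by
  obtain ⟨O, hO, h⟩ := exists_isOpen_curveDomain hc p
  exact pd_hasDerivAt_fst hO h (contDiffOn_chartCurve hc p) hq

omit [IsManifold 𝓘(ℝ, E) ∞ M] in
theorem eventually_mem_curveDomain {T : ℝ} {c : Circle → ℝ → M} (hc : IsSmoothFamily E T c) {p : M}
    {x t : ℝ} (hq : (x, t) ∈ curveDomain E T c p) :
    ∀ᶠ ξ in nhds x, (ξ, t) ∈ curveDomain E T c p := by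
  obtain ⟨O, hO, h⟩ := exists_isOpen_curveDomain hc p
  rw [h] at hq ⊢
  have hm : (fun ξ : ℝ => ((ξ, t) : ℝ × ℝ)) ⁻¹' O ∈ nhds x :=
    (hO.preimage (by fun_prop)).mem_nhds hq.2
  filter_upwards [hm] with ξ hξ
  exact ⟨⟨mem_univ _, hq.1.2⟩, hξ⟩

omit [IsManifold 𝓘(ℝ, E) ∞ M] in
theorem curveDomain_mem_nhdsWithin {T : ℝ} {c : Circle → ℝ → M} (hc : IsSmoothFamily E T c) {p : M}
    {q : ℝ × ℝ} (hq : q ∈ curveDomain E T c p) :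
    curveDomain E T c p ∈ nhdsWithin q (univ ×ˢ Icc 0 T) := by
  obtain ⟨O, hO, h⟩ := exists_isOpen_curveDomain hc p
  rw [h] at hq ⊢
  exact Filter.inter_mem self_mem_nhdsWithin (mem_nhdsWithin_of_mem_nhds (hO.mem_nhds hq.2))

/-- The velocity is represented by the velocity of the curve in a chart. -/
theorem velocity_eq {T : ℝ} {c : Circle → ℝ → M} (hc : IsSmoothFamily E T c) {p : M}
    {x t : ℝ} (hq : (x, t) ∈ curveDomain E T c p) :
    velocity E c x t = chartDeriv E p (chartCurve E c p (x, t))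
      (pd (curveDomain E T c p) (1, 0) (chartCurve E c p) (x, t)) := by
  have h1 : (fun ξ : ℝ => c (Circle.exp ξ) t) =ᶠ[nhds x]
      (extChartAt 𝓘(ℝ, E) p).symm ∘ coordCurve E c p t := by
    filter_upwards [eventually_mem_curveDomain hc hq] with ξ hξ
    exact (symm_chartCurve hξ).symm
  have hd := hasDerivAt_chartCurve hc hq
  have h2 := mfderiv_comp (I := 𝓘(ℝ, ℝ)) (I' := 𝓘(ℝ, E)) (I'' := 𝓘(ℝ, E)) x
    (mdifferentiableAt_chart_symm (chartCurve_mem hq)) hd.differentiableAt.mdifferentiableAt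
  have h3 := h1.mfderiv_eq (I := 𝓘(ℝ, ℝ)) (I' := 𝓘(ℝ, E))
  rw [mfderiv_eq_fderiv] at h2
  have h4 := DFunLike.congr_fun (h3.trans h2) (1 : ℝ)
  refine h4.trans ?_
  rw [← hd.deriv, ← fderiv_apply_one_eq_deriv]
  rfl

theorem speed_eq {T : ℝ} {c : Circle → ℝ → M} (hc : IsSmoothFamily E T c)
    (g : ℝ → SmoothMetric E M) {p : M} {x t : ℝ} (hq : (x, t) ∈ curveDomain E T c p) :
    speed g c x t = len (fun q => chartMetric g p (graphMap (chartCurve E c p) q))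
      (pd (curveDomain E T c p) (1, 0) (chartCurve E c p)) (x, t) := by
  have h1 : speed g c x t = Real.sqrt (metricAt (g t) (c (Circle.exp x) t)
    (velocity E c x t) (velocity E c x t)) := rfl
  rw [h1, velocity_eq hc hq]
  simp only [len, chartMetric, graphMap, coordMetric_apply, symm_chartCurve hq]

theorem coordUnitTangent_eq {T : ℝ} {c : Circle → ℝ → M} (hc : IsSmoothFamily E T c)
    (g : ℝ → SmoothMetric E M) {p : M} {x t : ℝ} (hq : (x, t) ∈ curveDomain E T c p) :
    coordUnitTangent g c p t x
      = unitField (fun q => chartMetric g p (graphMap (chartCurve E c p) q))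
        (pd (curveDomain E T c p) (1, 0) (chartCurve E c p)) (x, t) := by
  rw [coordUnitTangent, speed_eq hc g hq, (hasDerivAt_chartCurve hc hq).deriv]
  rfl

theorem pd_x_ne_zero {T : ℝ} {c : Circle → ℝ → M} (hc : IsSmoothFamily E T c) {p : M}
    {x t : ℝ} (hq : (x, t) ∈ curveDomain E T c p) (hv : velocity E c x t ≠ 0) :
    pd (curveDomain E T c p) (1, 0) (chartCurve E c p) (x, t) ≠ 0 := by
  intro h0
  rw [velocity_eq hc hq, h0] at hv
  exact hv (map_zero (chartDeriv E p (chartCurve E c p (x, t))))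

variable [FiniteDimensional ℝ E]

theorem christoffel_slice {T : ℝ} (hT : 0 < T) {g : ℝ → SmoothMetric E M}
    (hg : IsRicciFlow T g) {p : M} {y : E} {t : ℝ} (hy : y ∈ chartDomain E p) (ht : t ∈ Icc 0 T)
    (u v : E) :
    christoffel (chartDomain E p) (coordMetric (g t) p) y u v
      = christoffelMap (chartDomain E p ×ˢ Icc 0 T) (chartMetric g p) (y, t) u v := by
  rw [christoffel_eq]
  have := fderivWithin_slice (isOpen_chartDomain p).uniqueDiffOn hy ht
    (isMetricFamily_chartMetric hT hg p).smooth
  simp only [christoffelMap, spaceDeriv, ← this]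
  rfl

/-- The covariant derivative along the curve of a vector field given in a chart. -/
theorem covDerivAlong_eq {T : ℝ} (hT : 0 < T) {g : ℝ → SmoothMetric E M}
    (hg : IsRicciFlow T g) {c : Circle → ℝ → M} (hc : IsSmoothFamily E T c) {p : M}
    {x t : ℝ} (hq : (x, t) ∈ curveDomain E T c p) {Y : ℝ × ℝ → E} {Y' : ℝ → E}
    (hY : ContDiffOn ℝ ∞ Y (curveDomain E T c p))
    (hY' : ∀ ξ, (ξ, t) ∈ curveDomain E T c p → Y' ξ = Y (ξ, t)) :
    covDerivAlong (chartDomain E p) (coordMetric (g t) p) (coordCurve E c p t) Y' x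
      = cov (curveDomain E T c p) (1, 0) (connForm (curveDomain E T c p)
          (chartDomain E p ×ˢ Icc 0 T) (chartMetric g p) (chartCurve E c p) (1, 0)) Y (x, t) := by
  obtain ⟨O, hO, h⟩ := exists_isOpen_curveDomain hc p
  have h1 : Y' =ᶠ[nhds x] fun ξ => Y (ξ, t) := by
    filter_upwards [eventually_mem_curveDomain hc hq] with ξ hξ using hY' ξ hξ
  rw [covDerivAlong, h1.deriv_eq, (pd_hasDerivAt_fst hO h hY hq).deriv,
    (hasDerivAt_chartCurve hc hq).deriv, christoffel_slice hT hg (y := coordCurve E c p t x) (t := t) (chartCurve_mem hq) hq.1,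
    hY' x hq]
  rfl

omit [FiniteDimensional ℝ E] in
theorem pd_t_chartCurve {T : ℝ} (hT : 0 < T) {g : ℝ → SmoothMetric E M}
    {c : Circle → ℝ → M} (hc : IsCurveShrinkingFlow T g c) {p : M}
    {x t : ℝ} (hq : (x, t) ∈ curveDomain E T c p) :
    pd (curveDomain E T c p) (0, 1) (chartCurve E c p) (x, t)
      = coordCurvatureVector g c p t x := by
  obtain ⟨O, hO, h⟩ := exists_isOpen_curveDomain hc.smooth p
  exact (uniqueDiffOn_Icc hT t hq.1).eq_deriv _
    (pd_hasDerivWithinAt_snd hO h (contDiffOn_chartCurve hc.smooth p) hq)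
    (hc.flow p x t hq.1 hq.2)

theorem isCoordFlow {T : ℝ} (hT : 0 < T) {g : ℝ → SmoothMetric E M}
    (hg : IsRicciFlow T g) {c : Circle → ℝ → M} (hc : IsCurveShrinkingFlow T g c) (p : M) :
    IsCoordFlow (curveDomain E T c p) (chartDomain E p ×ˢ Icc 0 T) (chartMetric g p)
      (chartCurve E c p) where
  metric := isMetricFamily_chartMetric hT hg p
  unique := uniqueDiffOn_curveDomain hT hc.smooth p
  closure := curveDomain_subset_closure hT hc.smooth p
  smooth := contDiffOn_chartCurve hc.smooth p
  mapsTo _ hq := ⟨chartCurve_mem hq, hq.1⟩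
  immersed q hq := pd_x_ne_zero hc.smooth hq (hc.immersed q.1 q.2 hq.1)
  flow := by
    have hm := isMetricFamily_chartMetric hT hg p
    have hX := contDiffOn_pd (e := (1, 0)) (uniqueDiffOn_curveDomain hT hc.smooth p)
      (contDiffOn_chartCurve hc.smooth p)
    have hG : ContDiffOn ℝ ∞ (fun q => chartMetric g p (graphMap (chartCurve E c p) q))
        (curveDomain E T c p) :=
      hm.smooth.comp (contDiffOn_graphMap (contDiffOn_chartCurve hc.smooth p))
        fun q hq => ⟨chartCurve_mem hq, hq.1⟩
    have hpos : ∀ q ∈ curveDomain E T c p, chartMetric g p (graphMap (chartCurve E c p) q)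
        (pd (curveDomain E T c p) (1, 0) (chartCurve E c p) q)
        (pd (curveDomain E T c p) (1, 0) (chartCurve E c p) q) ≠ 0 := fun q hq =>
      (hm.posDef _ ⟨chartCurve_mem hq, hq.1⟩ _
        (pd_x_ne_zero hc.smooth hq (hc.immersed q.1 q.2 hq.1))).ne'
    -- Smoothness of S is proved by hand: `PulledBackFlow.smooth_unit` presupposes the flow equation
    -- being established here.
    have hS : ContDiffOn ℝ ∞ (unitField
        (fun q => chartMetric g p (graphMap (chartCurve E c p) q))
        (pd (curveDomain E T c p) (1, 0) (chartCurve E c p))) (curveDomain E T c p) :=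
      ((((hG.clm_apply hX).clm_apply hX).sqrt hpos).inv fun q hq => (Real.sqrt_pos.2
        (lt_of_le_of_ne ((hm.posDef _ ⟨chartCurve_mem hq, hq.1⟩).nonneg _)
          (hpos q hq).symm)).ne').smul hX
    rintro ⟨x, t⟩ hq
    rw [pd_t_chartCurve hT hc hq, coordCurvatureVector, speed_eq hc.smooth g hq,
      covDerivAlong_eq hT hg hc.smooth hq hS
        (fun ξ hξ => coordUnitTangent_eq hc.smooth g hξ)]

end Curves

/-! ### Change of charts -/

section ChangeOfCharts

variable {E : Type*} [NormedAddCommGroup E] [NormedSpace ℝ E]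
  {M : Type*} [TopologicalSpace M] [ChartedSpace E M] [IsManifold 𝓘(ℝ, E) ∞ M]

theorem pd_chartCurve_transition {T : ℝ} (hT : 0 < T) {c : Circle → ℝ → M}
    (hc : IsSmoothFamily E T c) {p p' : M} {q : ℝ × ℝ} (hq : q ∈ curveDomain E T c p)
    (hq' : q ∈ curveDomain E T c p') (e : ℝ × ℝ) :
    pd (curveDomain E T c p') e (chartCurve E c p') q
      = fderiv ℝ (transition E p p') (chartCurve E c p q)
        (pd (curveDomain E T c p) e (chartCurve E c p) q) := by
  -- The two derivatives are taken within different sets. Both sets are neighbourhoods of q relative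
  -- to the strip ℝ × [0,T], where derivatives are unique.
  have hu : UniqueDiffWithinAt ℝ ((univ : Set ℝ) ×ˢ Icc 0 T) q :=
    uniqueDiffOn_univ.prod (uniqueDiffOn_Icc hT) q ⟨mem_univ _, hq.1⟩
  have h1 : HasFDerivWithinAt (chartCurve E c p)
      (fderivWithin ℝ (chartCurve E c p) (curveDomain E T c p) q) (univ ×ˢ Icc 0 T) q :=
    (((contDiffOn_chartCurve hc p).differentiableWithinAt_of_mem
      hq).hasFDerivWithinAt).mono_of_mem_nhdsWithin (curveDomain_mem_nhdsWithin hc hq)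
  have h2 : HasFDerivWithinAt (chartCurve E c p')
      (fderivWithin ℝ (chartCurve E c p') (curveDomain E T c p') q) (univ ×ˢ Icc 0 T) q :=
    (((contDiffOn_chartCurve hc p').differentiableWithinAt_of_mem
      hq').hasFDerivWithinAt).mono_of_mem_nhdsWithin (curveDomain_mem_nhdsWithin hc hq')
  have h3 := ((contDiffAt_transition
    (chartCurve_mem_transitionDomain hq hq')).differentiableAt (by simp)).hasFDerivAt
  have h4 := (h3.comp_hasFDerivWithinAt q h1).congr_of_eventuallyEq
    (f₁ := chartCurve E c p')
    (by filter_upwards [curveDomain_mem_nhdsWithin hc hq] with z hz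
        exact (transition_chartCurve hz).symm)
    (transition_chartCurve hq).symm
  exact DFunLike.congr_fun (hu.eq h2 h4) e

/-- Two charts give the same metric. -/
theorem chartMetric_transition (g : ℝ → SmoothMetric E M) {p p' : M} {y : E} (t : ℝ)
    (hy : y ∈ transitionDomain E p p') (u v : E) :
    chartMetric g p (y, t) u v = chartMetric g p' (transition E p p' y, t)
      (fderiv ℝ (transition E p p') y u) (fderiv ℝ (transition E p p') y v) :=
  coordMetric_transition (g t) hy u v

variable [FiniteDimensional ℝ E]

/-- The transition map does not depend on t, so the tensor law of the metric can be differentiated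
in time at a fixed point. -/
theorem timeDeriv_transition {T : ℝ} (hT : 0 < T) {g : ℝ → SmoothMetric E M}
    (hg : IsRicciFlow T g) {p p' : M} {y : E} {t : ℝ} (hy : y ∈ transitionDomain E p p')
    (ht : t ∈ Icc 0 T) (u v : E) :
    timeDeriv (chartDomain E p ×ˢ Icc 0 T) (chartMetric g p) (y, t) u v
      = timeDeriv (chartDomain E p' ×ˢ Icc 0 T) (chartMetric g p') (transition E p p' y, t)
        (fderiv ℝ (transition E p p') y u) (fderiv ℝ (transition E p p') y v) := by
  have key : ∀ (p : M) (y : E), y ∈ chartDomain E p → ∀ u v : E,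
      HasDerivWithinAt (fun τ => chartMetric g p (y, τ) u v)
        (timeDeriv (chartDomain E p ×ˢ Icc 0 T) (chartMetric g p) (y, t) u v) (Icc 0 T) t := by
    intro p y hy u v
    have h1 := ((isMetricFamily_chartMetric hT hg p).smooth.differentiableWithinAt_of_mem
      (q := (y, t)) ⟨hy, ht⟩).hasFDerivWithinAt
    have h2 : HasDerivWithinAt (fun τ : ℝ => ((y, τ) : E × ℝ)) (0, 1) (Icc 0 T) t :=
      (hasDerivWithinAt_const t _ y).prodMk (hasDerivWithinAt_id t _)
    have h3 := h1.comp_hasDerivWithinAt t h2 (fun τ hτ => ⟨hy, hτ⟩)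
    have h4 := (h3.clm_apply (hasDerivWithinAt_const t _ u)).clm_apply
      (hasDerivWithinAt_const t _ v)
    exact h4.congr_deriv (by simp [timeDeriv])
  have h1 := key p y hy.1 u v
  have h2 := key p' _ (transition_mem hy) (fderiv ℝ (transition E p p') y u)
    (fderiv ℝ (transition E p p') y v)
  refine (uniqueDiffOn_Icc hT t ht).eq_deriv _ (h1.congr_of_eventuallyEq ?_ ?_) h2
  · filter_upwards with τ
    exact (chartMetric_transition g τ hy u v).symm
  · exact (chartMetric_transition g t hy u v).symm

/-- The Christoffel symbols in two charts. -/
theorem christoffelMap_transition {T : ℝ} (hT : 0 < T) {g : ℝ → SmoothMetric E M}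
    (hg : IsRicciFlow T g) {p p' : M} {y : E} {t : ℝ} (hy : y ∈ transitionDomain E p p')
    (ht : t ∈ Icc 0 T) (u v : E) :
    fderiv ℝ (fderiv ℝ (transition E p p')) y u v
      + christoffelMap (chartDomain E p' ×ˢ Icc 0 T) (chartMetric g p') (transition E p p' y, t)
        (fderiv ℝ (transition E p p') y u) (fderiv ℝ (transition E p p') y v)
      = fderiv ℝ (transition E p p') y
        (christoffelMap (chartDomain E p ×ˢ Icc 0 T) (chartMetric g p) (y, t) u v) := by
  have hm := isMetricFamily_chartMetric hT hg p
  have hm' := isMetricFamily_chartMetric hT hg p'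
  have hz : (y, t) ∈ chartDomain E p ×ˢ Icc 0 T := ⟨hy.1, ht⟩
  have hz' : (transition E p p' y, t) ∈ chartDomain E p' ×ˢ Icc 0 T := ⟨transition_mem hy, ht⟩
  have key : ∀ (p : M) (y : E), y ∈ chartDomain E p →
      HasFDerivAt (fun z => chartMetric g p (z, t))
        (spaceDeriv (chartDomain E p ×ˢ Icc 0 T) (chartMetric g p) (y, t)) y := by
    intro p y hy
    have h1 := ((isMetricFamily_chartMetric hT hg p).smooth.differentiableWithinAt_of_mem
      (q := (y, t)) ⟨hy, ht⟩).hasFDerivWithinAt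
    have h2 : HasFDerivWithinAt (fun y : E => ((y, t) : E × ℝ)) (ContinuousLinearMap.inl ℝ E ℝ)
        (chartDomain E p) y :=
      (hasFDerivWithinAt_id y _).prodMk (hasFDerivWithinAt_const t y _)
    exact (h1.comp y h2 (fun z (hz : z ∈ chartDomain E p) =>
      show (z, t) ∈ chartDomain E p ×ˢ Icc 0 T from ⟨hz, ht⟩)).hasFDerivAt ((isOpen_chartDomain p).mem_nhds hy)
  have hφ := contDiffAt_transition hy
  have hφ1 : HasFDerivAt (transition E p p') (fderiv ℝ (transition E p p') y) y :=
    (hφ.differentiableAt (by simp)).hasFDerivAt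
  have hφ2 : HasFDerivAt (fderiv ℝ (transition E p p'))
      (fderiv ℝ (fderiv ℝ (transition E p p')) y) y :=
    ((hφ.fderiv_right (m := 1) (by exact two_le_infty)).differentiableAt (by simp)).hasFDerivAt
  refine christoffelForm_transform (hm.posDef _ hz) (hm'.posDef _ hz') (hm'.symm _ hz')
    (surjective_fderiv_transition hy)
    (fun u v => (hφ.isSymmSndFDerivAt (by simpa using two_le_infty)).eq u v)
    (chartMetric_transition g t hy) (fun w u v => ?_) u v
  -- Differentiating the tensor law of the metric in space gives the relation between D and D'.
  have h1 := ((key p y hy.1).clm_apply (hasFDerivAt_const u y)).clm_apply (hasFDerivAt_const v y)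
  have h2 := (((key p' _ (transition_mem hy)).comp y hφ1).clm_apply
    (hφ2.clm_apply (hasFDerivAt_const u y))).clm_apply (hφ2.clm_apply (hasFDerivAt_const v y))
  have h3 := h2.congr_of_eventuallyEq (f₁ := fun z => chartMetric g p (z, t) u v) (by
    filter_upwards [(isOpen_transitionDomain p p').mem_nhds hy] with z hz
    exact chartMetric_transition g t hz u v)
  have h4 := DFunLike.congr_fun (h1.unique h3) w
  simp at h4
  rw [h4]
  ring

end ChangeOfCharts

/-! ### The geometric quantities in an arbitrary chart -/

section Invariants

variable {E : Type*} [NormedAddCommGroup E] [NormedSpace ℝ E]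
  {M : Type*} [TopologicalSpace M] [ChartedSpace E M] [IsManifold 𝓘(ℝ, E) ∞ M]
  [FiniteDimensional ℝ E]

/-- The square of the curvature, computed in the chart around `p`. -/
def chartCurvatureSq (T : ℝ) (g : ℝ → SmoothMetric E M) (c : Circle → ℝ → M) (p : M)
    (q : ℝ × ℝ) : ℝ :=
  chartMetric g p (graphMap (chartCurve E c p) q)
    (pd (curveDomain E T c p) (0, 1) (chartCurve E c p) q)
    (pd (curveDomain E T c p) (0, 1) (chartCurve E c p) q)

/-- The definition uses a chart varying with (x,t). Because H = ∂c/∂t, it transforms as a vector by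
the chain rule, and k² can be differentiated in a fixed chart. -/
theorem curvature_sq_eq {T : ℝ} (hT : 0 < T) {g : ℝ → SmoothMetric E M}
    (hg : IsRicciFlow T g) {c : Circle → ℝ → M} (hc : IsCurveShrinkingFlow T g c) {p : M}
    {x t : ℝ} (hq : (x, t) ∈ curveDomain E T c p) :
    curvature g c x t ^ 2 = chartCurvatureSq T g c p (x, t) := by
  set p' := c (Circle.exp x) t with hp'
  have hq' : (x, t) ∈ curveDomain E T c p' := mem_curveDomain_self hq.1
  have h1 : curvature g c x t = Real.sqrt (chartMetric g p' (graphMap (chartCurve E c p') (x, t))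
    (coordCurvatureVector g c p' t x) (coordCurvatureVector g c p' t x)) := rfl
  rw [h1, Real.sq_sqrt (((isMetricFamily_chartMetric hT hg p').posDef _
    ⟨chartCurve_mem hq', hq.1⟩).nonneg _), ← pd_t_chartCurve hT hc hq',
    pd_chartCurve_transition hT hc.smooth hq hq']
  simp only [chartCurvatureSq, graphMap]
  rw [chartMetric_transition g t (chartCurve_mem_transitionDomain hq hq'),
    transition_chartCurve hq]

/-- The covariant derivative `∇_x H` in two charts. -/
theorem cov_H_transition {T : ℝ} (hT : 0 < T) {g : ℝ → SmoothMetric E M}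
    (hg : IsRicciFlow T g) {c : Circle → ℝ → M} (hc : IsSmoothFamily E T c) {p p' : M}
    {x t : ℝ} (hq : (x, t) ∈ curveDomain E T c p) (hq' : (x, t) ∈ curveDomain E T c p') :
    cov (curveDomain E T c p') (1, 0) (connForm (curveDomain E T c p')
        (chartDomain E p' ×ˢ Icc 0 T) (chartMetric g p') (chartCurve E c p') (1, 0))
        (pd (curveDomain E T c p') (0, 1) (chartCurve E c p')) (x, t)
      = fderiv ℝ (transition E p p') (chartCurve E c p (x, t))
        (cov (curveDomain E T c p) (1, 0) (connForm (curveDomain E T c p)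
          (chartDomain E p ×ˢ Icc 0 T) (chartMetric g p) (chartCurve E c p) (1, 0))
          (pd (curveDomain E T c p) (0, 1) (chartCurve E c p)) (x, t)) := by
  obtain ⟨O, hO, h⟩ := exists_isOpen_curveDomain hc p
  obtain ⟨O', hO', h'⟩ := exists_isOpen_curveDomain hc p'
  have hy := chartCurve_mem_transitionDomain hq hq'
  have hφ2 : HasFDerivAt (fderiv ℝ (transition E p p'))
      (fderiv ℝ (fderiv ℝ (transition E p p')) (chartCurve E c p (x, t)))
      (chartCurve E c p (x, t)) :=
    (((contDiffAt_transition hy).fderiv_right (m := 1)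
      (by exact two_le_infty)).differentiableAt (by simp)).hasFDerivAt
  have d1 := pd_hasDerivAt_fst hO h (contDiffOn_pd (e := (0, 1))
    (uniqueDiffOn_curveDomain hT hc p) (contDiffOn_chartCurve hc p)) hq
  have d2 := pd_hasDerivAt_fst hO' h' (contDiffOn_pd (e := (0, 1))
    (uniqueDiffOn_curveDomain hT hc p') (contDiffOn_chartCurve hc p')) hq'
  -- The x-derivative of H' = Dφ(H) contains D²φ(X,H), which the inhomogeneous term in the law of
  -- the Christoffel symbols absorbs.
  have d3 := (hφ2.comp_hasDerivAt x (hasDerivAt_chartCurve hc hq)).clm_apply d1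
  have d4 := d3.congr_of_eventuallyEq
    (f₁ := fun ξ => pd (curveDomain E T c p') (0, 1) (chartCurve E c p') (ξ, t)) (by
      filter_upwards [eventually_mem_curveDomain hc hq, eventually_mem_curveDomain hc hq']
        with ξ h1 h2
      exact pd_chartCurve_transition hT hc h1 h2 _)
  have h3 := d2.unique d4
  simp only [cov, connForm, graphMap]
  rw [h3, pd_chartCurve_transition hT hc hq hq', pd_chartCurve_transition hT hc hq hq', map_add,
    ← transition_chartCurve (p' := p') hq, ← christoffelMap_transition hT hg hy hq.1]
  simp only [Function.comp_apply]
  change _ + _ + _ = _ + (_ + _)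
  rw [← add_assoc, add_comm (fderiv ℝ (transition E p p') _ _)]
  rfl

omit [FiniteDimensional ℝ E] in
theorem len_transition {T : ℝ} {g : ℝ → SmoothMetric E M}
    {c : Circle → ℝ → M} (hc : IsSmoothFamily E T c) {p p' : M}
    {x t : ℝ} (hq : (x, t) ∈ curveDomain E T c p) (hq' : (x, t) ∈ curveDomain E T c p') :
    len (fun q => chartMetric g p' (graphMap (chartCurve E c p') q))
      (pd (curveDomain E T c p') (1, 0) (chartCurve E c p')) (x, t)
    = len (fun q => chartMetric g p (graphMap (chartCurve E c p) q))
      (pd (curveDomain E T c p) (1, 0) (chartCurve E c p)) (x, t) := by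
  rw [← speed_eq hc g hq, speed_eq hc g hq']

omit [FiniteDimensional ℝ E] in
theorem unitField_transition {T : ℝ} (hT : 0 < T) {g : ℝ → SmoothMetric E M}
    {c : Circle → ℝ → M} (hc : IsSmoothFamily E T c) {p p' : M}
    {x t : ℝ} (hq : (x, t) ∈ curveDomain E T c p) (hq' : (x, t) ∈ curveDomain E T c p') :
    unitField (fun q => chartMetric g p' (graphMap (chartCurve E c p') q))
      (pd (curveDomain E T c p') (1, 0) (chartCurve E c p')) (x, t)
    = fderiv ℝ (transition E p p') (chartCurve E c p (x, t))
      (unitField (fun q => chartMetric g p (graphMap (chartCurve E c p) q))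
        (pd (curveDomain E T c p) (1, 0) (chartCurve E c p)) (x, t)) := by
  rw [unitField, len_transition hc hq hq', pd_chartCurve_transition hT hc hq hq', unitField,
    map_smul]

theorem perpDerivH_transition {T : ℝ} (hT : 0 < T) {g : ℝ → SmoothMetric E M}
    (hg : IsRicciFlow T g) {c : Circle → ℝ → M} (hc : IsSmoothFamily E T c) {p p' : M}
    {x t : ℝ} (hq : (x, t) ∈ curveDomain E T c p) (hq' : (x, t) ∈ curveDomain E T c p') :
    IsCoordFlow.perpDerivH (curveDomain E T c p') (chartDomain E p' ×ˢ Icc 0 T) (chartMetric g p')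
      (chartCurve E c p') (x, t)
    = fderiv ℝ (transition E p p') (chartCurve E c p (x, t))
      (IsCoordFlow.perpDerivH (curveDomain E T c p) (chartDomain E p ×ˢ Icc 0 T) (chartMetric g p)
        (chartCurve E c p) (x, t)) := by
  have hy := chartCurve_mem_transitionDomain hq hq'
  simp only [IsCoordFlow.perpDerivH]
  rw [cov_H_transition hT hg hc hq hq', len_transition hc hq hq',
    unitField_transition hT hc hq hq', ← map_smul]
  simp only [graphMap]
  rw [← transition_chartCurve (p' := p') hq, ← chartMetric_transition g t hy, ← map_smul,
    ← map_sub]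

/-- `|(∇_S H)^⊥|²` in the chart around `p`. -/
def chartNormSqPerp (T : ℝ) (g : ℝ → SmoothMetric E M) (c : Circle → ℝ → M) (p : M)
    (q : ℝ × ℝ) : ℝ :=
  chartMetric g p (graphMap (chartCurve E c p) q)
      (IsCoordFlow.perpDerivH (curveDomain E T c p) (chartDomain E p ×ˢ Icc 0 T) (chartMetric g p)
        (chartCurve E c p) q)
      (IsCoordFlow.perpDerivH (curveDomain E T c p) (chartDomain E p ×ˢ Icc 0 T) (chartMetric g p)
        (chartCurve E c p) q)
    + (1 / 4) * timeDeriv (chartDomain E p ×ˢ Icc 0 T) (chartMetric g p)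
        (graphMap (chartCurve E c p) q)
        (unitField (fun q => chartMetric g p (graphMap (chartCurve E c p) q))
          (pd (curveDomain E T c p) (1, 0) (chartCurve E c p)) q)
        (pd (curveDomain E T c p) (0, 1) (chartCurve E c p) q) ^ 2

theorem chartNormSqPerp_transition {T : ℝ} (hT : 0 < T) {g : ℝ → SmoothMetric E M}
    (hg : IsRicciFlow T g) {c : Circle → ℝ → M} (hc : IsSmoothFamily E T c) {p p' : M}
    {x t : ℝ} (hq : (x, t) ∈ curveDomain E T c p) (hq' : (x, t) ∈ curveDomain E T c p') :
    chartNormSqPerp T g c p' (x, t) = chartNormSqPerp T g c p (x, t) := by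
  have hy := chartCurve_mem_transitionDomain hq hq'
  rw [chartNormSqPerp, chartNormSqPerp, perpDerivH_transition hT hg hc hq hq',
    unitField_transition hT hc hq hq', pd_chartCurve_transition hT hc hq hq']
  simp only [graphMap]
  rw [← transition_chartCurve (p' := p') hq, ← chartMetric_transition g t hy,
    ← timeDeriv_transition hT hg hy hq.1]

/-- The Levi-Civita connection of the spacetime metric. -/
theorem normSqPerpDerivH_eq_self {T : ℝ} (hT : 0 < T) {g : ℝ → SmoothMetric E M}
    (hg : IsRicciFlow T g) {c : Circle → ℝ → M} (hc : IsCurveShrinkingFlow T g c) {x t : ℝ}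
    (ht : t ∈ Icc 0 T) :
    normSqPerpDerivH T g c x t = chartNormSqPerp T g c (c (Circle.exp x) t) (x, t) := by
  set p := c (Circle.exp x) t with hp
  have hq : (x, t) ∈ curveDomain E T c p := mem_curveDomain_self ht
  have hm := isMetricFamily_chartMetric hT hg p
  have hz : (coordCurve E c p t x, t) ∈ chartDomain E p ×ˢ Icc 0 T := ⟨chartCurve_mem hq, ht⟩
  obtain ⟨O, hO, h⟩ := exists_isOpen_curveDomain hc.smooth p
  set S := unitField (fun q => chartMetric g p (graphMap (chartCurve E c p) q))
    (pd (curveDomain E T c p) (1, 0) (chartCurve E c p)) (x, t) with hS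
  set X := pd (curveDomain E T c p) (1, 0) (chartCurve E c p) (x, t) with hX
  set H := pd (curveDomain E T c p) (0, 1) (chartCurve E c p) (x, t) with hH
  set D := cov (curveDomain E T c p) (1, 0) (connForm (curveDomain E T c p)
    (chartDomain E p ×ˢ Icc 0 T) (chartMetric g p) (chartCurve E c p) (1, 0))
    (pd (curveDomain E T c p) (0, 1) (chartCurve E c p)) (x, t) with hD
  set l := len (fun q => chartMetric g p (graphMap (chartCurve E c p) q))
    (pd (curveDomain E T c p) (1, 0) (chartCurve E c p)) (x, t) with hl
  have hSX : S = l⁻¹ • X := rfl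
  set w := timeDeriv (chartDomain E p ×ˢ Icc 0 T) (chartMetric g p) (coordCurve E c p t x, t) S H
    with hw
  have hcov : covDerivAlong (chartDomain E p ×ˢ Icc 0 T) (coordSpacetimeMetric g p)
      (fun ξ => (coordCurve E c p t ξ, t)) (fun ξ => (coordCurvatureVector g c p t ξ, (0 : ℝ))) x
      = (D, -(1 / 2) * timeDeriv (chartDomain E p ×ˢ Icc 0 T) (chartMetric g p)
        (coordCurve E c p t x, t) X H) := by
    have d1 : HasDerivAt (fun ξ => (coordCurve E c p t ξ, t)) (X, (0 : ℝ)) x :=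
      (hasDerivAt_chartCurve hc.smooth hq).prodMk (hasDerivAt_const x t)
    have d2 := (pd_hasDerivAt_fst hO h (contDiffOn_pd (e := (0, 1))
      (uniqueDiffOn_curveDomain hT hc.smooth p) (contDiffOn_chartCurve hc.smooth p)) hq).prodMk
        (hasDerivAt_const x (0 : ℝ))
    have d3 := d2.congr_of_eventuallyEq
      (f₁ := fun ξ => (coordCurvatureVector g c p t ξ, (0 : ℝ))) (by
        filter_upwards [eventually_mem_curveDomain hc.smooth hq] with ξ hξ
        rw [pd_t_chartCurve hT hc hξ])
    rw [covDerivAlong, d1.deriv, d3.deriv, ← pd_t_chartCurve hT hc hq]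
    have h1 := christoffel_productMetric hm hz X H
    have h2 : coordSpacetimeMetric g p = fun z => productMetric (chartMetric g p z) := rfl
    rw [h2, h1]
    simp only [Prod.mk_add_mk, zero_add]
    rfl
  have hW : (speed g c x t)⁻¹ • covDerivAlong (chartDomain E p ×ˢ Icc 0 T)
      (coordSpacetimeMetric g p)
      (fun ξ => (coordCurve E c p t ξ, t)) (fun ξ => (coordCurvatureVector g c p t ξ, (0 : ℝ))) x
      = (l⁻¹ • D, -(1 / 2) * w) := by
    rw [hcov, speed_eq hc.smooth g hq, ← hl, hw, hSX, Prod.smul_mk]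
    simp only [map_smul, smul_apply, smul_eq_mul]
    congr 1
    ring
  have hdef : normSqPerpDerivH T g c x t =
      productMetric (chartMetric g p (coordCurve E c p t x, t))
        ((l⁻¹ • D, -(1 / 2) * w) - productMetric (chartMetric g p (coordCurve E c p t x, t))
          (l⁻¹ • D, -(1 / 2) * w) (S, 0) • (S, 0))
        ((l⁻¹ • D, -(1 / 2) * w) - productMetric (chartMetric g p (coordCurve E c p t x, t))
          (l⁻¹ • D, -(1 / 2) * w) (S, 0) • (S, 0)) := by
    rw [← hW, hS, ← coordUnitTangent_eq hc.smooth g hq]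
    rfl
  have hperp : IsCoordFlow.perpDerivH (curveDomain E T c p) (chartDomain E p ×ˢ Icc 0 T)
      (chartMetric g p) (chartCurve E c p) (x, t)
      = l⁻¹ • D - chartMetric g p (coordCurve E c p t x, t) (l⁻¹ • D) S • S := rfl
  -- S has no time component, so projecting orthogonally to S leaves the time component -w/2
  -- untouched; its square is the summand w²/4.
  rw [hdef, chartNormSqPerp, hperp]
  simp only [productMetric_apply, mul_zero, add_zero, Prod.fst_sub, Prod.snd_sub, Prod.smul_mk,
    smul_eq_mul, sub_zero]
  change _ = _ + (1 / 4) * w ^ 2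
  rw [show -(1 / 2) * w * (-(1 / 2) * w) = (1 / 4) * w ^ 2 by ring]
  rfl

theorem normSqPerpDerivH_eq {T : ℝ} (hT : 0 < T) {g : ℝ → SmoothMetric E M}
    (hg : IsRicciFlow T g) {c : Circle → ℝ → M} (hc : IsCurveShrinkingFlow T g c) {p : M}
    {x t : ℝ} (hq : (x, t) ∈ curveDomain E T c p) :
    normSqPerpDerivH T g c x t = chartNormSqPerp T g c p (x, t) := by
  rw [normSqPerpDerivH_eq_self hT hg hc hq.1,
    chartNormSqPerp_transition hT hg hc.smooth hq (mem_curveDomain_self hq.1)]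

theorem normSqPerpDerivH_nonneg {T : ℝ} (hT : 0 < T) {g : ℝ → SmoothMetric E M}
    (hg : IsRicciFlow T g) {c : Circle → ℝ → M} (hc : IsCurveShrinkingFlow T g c) {x t : ℝ}
    (ht : t ∈ Icc 0 T) : 0 ≤ normSqPerpDerivH T g c x t := by
  have hq : (x, t) ∈ curveDomain E T c (c (Circle.exp x) t) := mem_curveDomain_self ht
  rw [normSqPerpDerivH_eq hT hg hc hq, chartNormSqPerp]
  have := ((isMetricFamily_chartMetric hT hg _).posDef
    (graphMap (chartCurve E c _) (x, t)) ⟨chartCurve_mem hq, ht⟩).nonneg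
  exact add_nonneg (this _) (mul_nonneg (by norm_num) (sq_nonneg _))

end Invariants

/-! ### Uniform bounds on compact sets -/

section UniformBounds

variable {E : Type*} [NormedAddCommGroup E] [NormedSpace ℝ E] [FiniteDimensional ℝ E]

/-- On K times the unit sphere, which is compact, 1/G(u,u) is bounded; homogeneity extends the bound
to all u. -/
theorem IsMetricFamily.exists_norm_le {U : Set (E × ℝ)} {G : E × ℝ → E →L[ℝ] E →L[ℝ] ℝ}
    (h : IsMetricFamily U G) {K : Set (E × ℝ)} (hK : IsCompact K) (hKU : K ⊆ U) :
    ∃ C : ℝ, 0 ≤ C ∧ ∀ z ∈ K, ∀ u, ‖u‖ ≤ C * Real.sqrt (G z u u) := by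
  have : ProperSpace E := FiniteDimensional.proper ℝ E
  have hc : ContinuousOn (fun a : (E × ℝ) × E => (G a.1 a.2 a.2)⁻¹) (K ×ˢ Metric.sphere 0 1) := by
    have h1 : ContinuousOn (fun a : (E × ℝ) × E => G a.1) (K ×ˢ Metric.sphere 0 1) :=
      (h.smooth.continuousOn.mono hKU).comp continuousOn_fst fun a ha => ha.1
    refine ((h1.clm_apply continuousOn_snd).clm_apply continuousOn_snd).inv₀ fun a ha => ?_
    refine (h.posDef _ (hKU ha.1) _ fun h0 => ?_).ne'
    have := ha.2
    rw [h0] at this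
    simp at this
  obtain ⟨C, hC⟩ := (hK.prod (isCompact_sphere (0 : E) 1)).exists_bound_of_continuousOn hc
  -- C bounds ‖u‖²/G(u,u); |C| + 1 dominates a square root of it, as C ≤ (|C| + 1)².
  refine ⟨|C| + 1, by positivity, fun z hz u => ?_⟩
  rcases eq_or_ne u 0 with rfl | hu
  · simp
  have hn : 0 < ‖u‖ := norm_pos_iff.2 hu
  have hG : 0 < G z u u := h.posDef z (hKU hz) u hu
  have h1 := hC (z, ‖u‖⁻¹ • u) ⟨hz, by simp [norm_smul, hn.ne']⟩
  simp only [map_smul, smul_apply, smul_eq_mul, Real.norm_eq_abs] at h1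
  have h2 : (‖u‖⁻¹ * (‖u‖⁻¹ * G z u u))⁻¹ = ‖u‖ ^ 2 / G z u u := by field_simp
  rw [h2, abs_of_pos (by positivity), div_le_iff₀ hG] at h1
  refine le_of_sq_le_sq ?_ (by positivity)
  rw [mul_pow, Real.sq_sqrt hG.le]
  have h3 : C ≤ (|C| + 1) ^ 2 := by nlinarith [le_abs_self C, abs_nonneg C]
  exact h1.trans (mul_le_mul_of_nonneg_right h3 hG.le)

theorem IsMetricFamily.exists_metricBound {U : Set (E × ℝ)} {G : E × ℝ → E →L[ℝ] E →L[ℝ] ℝ}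
    (h : IsMetricFamily U G) {K : Set (E × ℝ)} (hK : IsCompact K) (hKU : K ⊆ U) :
    ∃ C : ℝ, ∀ z ∈ K, MetricBound C U G z := by
  obtain ⟨C₀, h₀, hC₀⟩ := h.exists_norm_le hK hKU
  obtain ⟨C₁, hC₁⟩ := hK.exists_bound_of_continuousOn (h.smooth.continuousOn.mono hKU)
  have ht : ContDiffOn ℝ ∞ (timeDeriv U G) U :=
    h.smooth_fderivWithin.clm_apply contDiffOn_const
  obtain ⟨C₂, hC₂⟩ := hK.exists_bound_of_continuousOn (ht.continuousOn.mono hKU)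
  obtain ⟨C₃, hC₃⟩ := hK.exists_bound_of_continuousOn (h.smooth_christoffelMap.continuousOn.mono hKU)
  have hd : ContDiffOn ℝ ∞ (fderivWithin ℝ (christoffelMap U G) U) U :=
    h.smooth_christoffelMap.fderivWithin h.unique (m := ∞) (by simp)
  obtain ⟨C₄, hC₄⟩ := hK.exists_bound_of_continuousOn (hd.continuousOn.mono hKU)
  have a1 := abs_nonneg C₁
  have a2 := abs_nonneg C₂
  have a3 := abs_nonneg C₃
  have a4 := abs_nonneg C₄
  have b1 := le_abs_self C₁
  have b2 := le_abs_self C₂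
  have b3 := le_abs_self C₃
  have b4 := le_abs_self C₄
  refine ⟨C₀ + |C₁| + |C₂| + |C₃| + |C₄|, fun z hz => ⟨by positivity, fun u => ?_, ?_, ?_, ?_, ?_⟩⟩
  · exact (hC₀ z hz u).trans (mul_le_mul_of_nonneg_right (by linarith) (Real.sqrt_nonneg _))
  · linarith [hC₁ z hz]
  · linarith [hC₂ z hz]
  · linarith [hC₃ z hz]
  · linarith [hC₄ z hz]

theorem evolutionConst_nonneg {C : ℝ} (hC : 0 ≤ C) : 0 ≤ evolutionConst C := by
  unfold evolutionConst
  positivity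

end UniformBounds

/-! ### The evolution inequalities -/

section Evolution

variable {E : Type*} [NormedAddCommGroup E] [NormedSpace ℝ E]
  {M : Type*} [TopologicalSpace M] [ChartedSpace E M] [IsManifold 𝓘(ℝ, E) ∞ M]

theorem arcDeriv_eq {T : ℝ} {g : ℝ → SmoothMetric E M} {c : Circle → ℝ → M}
    (hc : IsSmoothFamily E T c) {p : M} {x t : ℝ} (hq : (x, t) ∈ curveDomain E T c p)
    {f : ℝ → ℝ → ℝ} {f' : ℝ × ℝ → ℝ} (hf' : ContDiffOn ℝ ∞ f' (curveDomain E T c p))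
    (hf : ∀ ξ, (ξ, t) ∈ curveDomain E T c p → f ξ t = f' (ξ, t)) :
    arcDeriv g c f x t = (len (fun q => chartMetric g p (graphMap (chartCurve E c p) q))
      (pd (curveDomain E T c p) (1, 0) (chartCurve E c p)) (x, t))⁻¹ *
        pd (curveDomain E T c p) (1, 0) f' (x, t) := by
  obtain ⟨O, hO, h⟩ := exists_isOpen_curveDomain hc p
  have h1 : (fun ξ => f ξ t) =ᶠ[nhds x] fun ξ => f' (ξ, t) := by
    filter_upwards [eventually_mem_curveDomain hc hq] with ξ hξ using hf ξ hξ
  rw [arcDeriv, h1.deriv_eq, (pd_hasDerivAt_fst hO h hf' hq).deriv, speed_eq hc g hq]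

omit [IsManifold 𝓘(ℝ, E) ∞ M] in
theorem derivWithin_time_eq {T : ℝ} (hT : 0 < T) {c : Circle → ℝ → M}
    (hc : IsSmoothFamily E T c) {p : M} {x t : ℝ} (hq : (x, t) ∈ curveDomain E T c p)
    {f : ℝ → ℝ → ℝ} {f' : ℝ × ℝ → ℝ} (hf' : ContDiffOn ℝ ∞ f' (curveDomain E T c p))
    (hf : ∀ τ, (x, τ) ∈ curveDomain E T c p → f x τ = f' (x, τ)) :
    derivWithin (fun τ => f x τ) (Icc 0 T) t = pd (curveDomain E T c p) (0, 1) f' (x, t) := by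
  obtain ⟨O, hO, h⟩ := exists_isOpen_curveDomain hc p
  have h1 := (pd_hasDerivWithinAt_snd hO h hf' hq).congr_of_eventuallyEq
    (f₁ := fun τ => f x τ) (by
      have hm : (fun τ : ℝ => ((x, τ) : ℝ × ℝ)) ⁻¹' O ∈ nhds t := by
        rw [h] at hq
        exact (hO.preimage (by fun_prop)).mem_nhds hq.2
      filter_upwards [self_mem_nhdsWithin, mem_nhdsWithin_of_mem_nhds hm] with τ hτ hτ'
      exact hf τ (by rw [h]; exact ⟨⟨mem_univ _, hτ⟩, hτ'⟩)) (hf t hq)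
  exact h1.derivWithin (uniqueDiffOn_Icc hT t hq.1)

variable [FiniteDimensional ℝ E]

theorem contDiffOn_chartCurvatureSq {T : ℝ} (hT : 0 < T) {g : ℝ → SmoothMetric E M}
    (hg : IsRicciFlow T g) {c : Circle → ℝ → M} (hc : IsCurveShrinkingFlow T g c) (p : M) :
    ContDiffOn ℝ ∞ (chartCurvatureSq T g c p) (curveDomain E T c p) :=
  (isCoordFlow hT hg hc p).pulledBackFlow.smooth_inner
    (isCoordFlow hT hg hc p).pulledBackFlow.smooth_H (isCoordFlow hT hg hc p).pulledBackFlow.smooth_H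

/-- Smoothness is local: near (x,t) the chart around c(x,t) can be kept fixed. -/
theorem contDiffOn_curvature_sq {T : ℝ} (hT : 0 < T) {g : ℝ → SmoothMetric E M}
    (hg : IsRicciFlow T g) {c : Circle → ℝ → M} (hc : IsCurveShrinkingFlow T g c) :
    ContDiffOn ℝ ∞ (fun q : ℝ × ℝ => curvature g c q.1 q.2 ^ 2) (univ ×ˢ Icc 0 T) := by
  rintro ⟨x, t⟩ hq
  have hq' : (x, t) ∈ curveDomain E T c (c (Circle.exp x) t) := mem_curveDomain_self hq.2
  refine ContDiffWithinAt.mono_of_mem_nhdsWithin ?_ (curveDomain_mem_nhdsWithin hc.smooth hq')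
  exact (contDiffOn_chartCurvatureSq hT hg hc _).congr
    (fun z hz => curvature_sq_eq hT hg hc hz) _ hq'

/-- The evolution inequality for `k²` at points where the metrics are bounded by `C` in some
chart, together with the bound for the derivative of `k²` along the curve. -/
theorem evolution_curvature_sq {T : ℝ} (hT : 0 < T) {g : ℝ → SmoothMetric E M}
    (hg : IsRicciFlow T g) {c : Circle → ℝ → M} (hc : IsCurveShrinkingFlow T g c) {p : M}
    {x t : ℝ} (hq : (x, t) ∈ curveDomain E T c p) {C : ℝ}
    (hC : MetricBound C (chartDomain E p ×ˢ Icc 0 T) (chartMetric g p)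
      (graphMap (chartCurve E c p) (x, t))) :
    derivWithin (fun τ => curvature g c x τ ^ 2) (Icc 0 T) t ≤
      arcDeriv g c (arcDeriv g c (fun ξ τ => curvature g c ξ τ ^ 2)) x t
        - 2 * normSqPerpDerivH T g c x t + 2 * curvature g c x t ^ 4
        + evolutionConst C * (curvature g c x t ^ 2 + curvature g c x t) := by
  have hf := isCoordFlow hT hg hc p
  have hF := contDiffOn_chartCurvatureSq hT hg hc p
  have h1 := derivWithin_time_eq hT hc.smooth hq hF
    (f := fun ξ τ => curvature g c ξ τ ^ 2) fun τ hτ => curvature_sq_eq hT hg hc hτ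
  have h2 := arcDeriv_eq (g := g) hc.smooth hq
    (hf.pulledBackFlow.smooth_inv_len.mul (contDiffOn_pd (e := (1, 0)) hf.unique hF))
    (f := arcDeriv g c (fun ξ τ => curvature g c ξ τ ^ 2))
    (fun ξ hξ => arcDeriv_eq (g := g) hc.smooth hξ hF fun η hη => curvature_sq_eq hT hg hc hη)
  have h3 : curvature g c x t = Real.sqrt (chartCurvatureSq T g c p (x, t)) := by
    rw [← curvature_sq_eq hT hg hc hq]
    exact (Real.sqrt_sq (Real.sqrt_nonneg _)).symm
  have h4 : curvature g c x t ^ 4 = chartCurvatureSq T g c p (x, t) ^ 2 := by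
    rw [← curvature_sq_eq hT hg hc hq]; ring
  rw [h1, h2, h4, curvature_sq_eq hT hg hc hq, h3, normSqPerpDerivH_eq hT hg hc hq]
  exact hf.pd_t_normSq_H_le hq hC

theorem arcDeriv_curvature_sq_le {T : ℝ} (hT : 0 < T) {g : ℝ → SmoothMetric E M}
    (hg : IsRicciFlow T g) {c : Circle → ℝ → M} (hc : IsCurveShrinkingFlow T g c)
    {x t : ℝ} (ht : t ∈ Icc 0 T) :
    arcDeriv g c (fun ξ τ => curvature g c ξ τ ^ 2) x t ^ 2
      ≤ 4 * normSqPerpDerivH T g c x t * curvature g c x t ^ 2 := by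
  set p := c (Circle.exp x) t with hp
  have hq : (x, t) ∈ curveDomain E T c p := mem_curveDomain_self ht
  have hf := isCoordFlow hT hg hc p
  rw [arcDeriv_eq (g := g) hc.smooth hq (contDiffOn_chartCurvatureSq hT hg hc p)
    fun η hη => curvature_sq_eq hT hg hc hη, normSqPerpDerivH_eq hT hg hc hq]
  refine (hf.pd_x_normSq_H_sq_le hq).trans ?_
  rw [curvature_sq_eq hT hg hc hq]
  -- Passing from the spatial to the ĝ-norm only adds the square Q(S,H)²/4.
  refine mul_le_mul_of_nonneg_right ?_ ((hf.metric.posDef _ (hf.mapsTo hq)).nonneg _)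
  rw [chartNormSqPerp]
  have : ∀ a b : ℝ, 4 * a ≤ 4 * (a + 1 / 4 * b ^ 2) := fun a b => by nlinarith [sq_nonneg b]
  exact this _ _

omit [FiniteDimensional ℝ E] in
theorem regCurvature_sq {g : ℝ → SmoothMetric E M} {c : Circle → ℝ → M} {ε : ℝ} (x t : ℝ) :
    regCurvature g c ε x t ^ 2 = curvature g c x t ^ 2 + ε ^ 2 :=
  Real.sq_sqrt (by positivity)

theorem contDiffOn_regCurvature {T : ℝ} (hT : 0 < T) {g : ℝ → SmoothMetric E M}
    (hg : IsRicciFlow T g) {c : Circle → ℝ → M} (hc : IsCurveShrinkingFlow T g c) {ε : ℝ}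
    (hε : 0 < ε) :
    ContDiffOn ℝ ∞ (fun q : ℝ × ℝ => regCurvature g c ε q.1 q.2) (univ ×ˢ Icc 0 T) :=
  ((contDiffOn_curvature_sq hT hg hc).add contDiffOn_const).sqrt fun q _ => by positivity

/-- The evolution inequality for `k²` implies the one for `√(k² + ε²)`. -/
theorem evolution_regCurvature {T : ℝ} (hT : 0 < T) {g : ℝ → SmoothMetric E M}
    (hg : IsRicciFlow T g) {c : Circle → ℝ → M} (hc : IsCurveShrinkingFlow T g c)
    {x t : ℝ} (ht' : t ∈ Icc 0 T) {K : ℝ} (hK : 0 ≤ K)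
    (hev : derivWithin (fun τ => curvature g c x τ ^ 2) (Icc 0 T) t ≤
      arcDeriv g c (arcDeriv g c (fun ξ τ => curvature g c ξ τ ^ 2)) x t
        - 2 * normSqPerpDerivH T g c x t + 2 * curvature g c x t ^ 4
        + K * (curvature g c x t ^ 2 + curvature g c x t)) {ε : ℝ} (hε : 0 < ε) :
    derivWithin (fun τ => regCurvature g c ε x τ) (Icc 0 T) t ≤
      arcDeriv g c (arcDeriv g c (regCurvature g c ε)) x t + curvature g c x t ^ 3
        + K / 2 * (regCurvature g c ε x t + 1) := by
  have hle := arcDeriv_curvature_sq_le hT hg hc (x := x) ht'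
  set p := c (Circle.exp x) t with hp
  have hq : (x, t) ∈ curveDomain E T c p := mem_curveDomain_self ht'
  have hf := isCoordFlow hT hg hc p
  have hu := hf.unique
  set s := curveDomain E T c p with hs
  set l : ℝ × ℝ → ℝ := fun q => (len (fun q => chartMetric g p (graphMap (chartCurve E c p) q))
    (pd s (1, 0) (chartCurve E c p)) q)⁻¹ with hl
  have sl : ContDiffOn ℝ ∞ l s := hf.pulledBackFlow.smooth_inv_len
  set h : ℝ × ℝ → ℝ := fun q => regCurvature g c ε q.1 q.2 with hh
  set f : ℝ × ℝ → ℝ := fun q => curvature g c q.1 q.2 ^ 2 with hfdef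
  have hsub : s ⊆ univ ×ˢ Icc 0 T := fun z hz => ⟨mem_univ _, hz.1⟩
  have sh : ContDiffOn ℝ ∞ h s := (contDiffOn_regCurvature hT hg hc hε).mono hsub
  have sf : ContDiffOn ℝ ∞ f s := (contDiffOn_curvature_sq hT hg hc).mono hsub
  have slh : ContDiffOn ℝ ∞ (fun z => l z * pd s (1, 0) h z) s := sl.mul (contDiffOn_pd hu sh)
  have slf : ContDiffOn ℝ ∞ (fun z => l z * pd s (1, 0) f z) s := sl.mul (contDiffOn_pd hu sf)
  have hfh : ∀ e : ℝ × ℝ, ∀ z ∈ s, pd s e f z = 2 * h z * pd s e h z := by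
    intro e z hz
    rw [← pd_sq hu sh hz, pd_congr (f := fun z => h z ^ 2) (f' := fun z => f z + ε ^ 2)
      (fun z _ => regCurvature_sq z.1 z.2) hz, pd_add hu sf contDiffOn_const hz, pd_const, add_zero]
  have e1 : derivWithin (fun τ => regCurvature g c ε x τ) (Icc 0 T) t = pd s (0, 1) h (x, t) :=
    derivWithin_time_eq hT hc.smooth hq sh fun _ _ => rfl
  have e2 : derivWithin (fun τ => curvature g c x τ ^ 2) (Icc 0 T) t = pd s (0, 1) f (x, t) :=
    derivWithin_time_eq (f := fun x τ => curvature g c x τ ^ 2) hT hc.smooth hq sf fun _ _ => rfl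
  have e3 : arcDeriv g c (arcDeriv g c (regCurvature g c ε)) x t
      = l (x, t) * pd s (1, 0) (fun z => l z * pd s (1, 0) h z) (x, t) :=
    arcDeriv_eq hc.smooth hq slh fun ξ hξ => arcDeriv_eq hc.smooth hξ sh fun _ _ => rfl
  have e4 : ∀ ξ, (ξ, t) ∈ s → arcDeriv g c (fun ξ τ => curvature g c ξ τ ^ 2) ξ t
      = l (ξ, t) * pd s (1, 0) f (ξ, t) := fun ξ hξ =>
    arcDeriv_eq hc.smooth hξ sf fun _ _ => rfl
  have e5 : arcDeriv g c (arcDeriv g c (fun ξ τ => curvature g c ξ τ ^ 2)) x t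
      = l (x, t) * pd s (1, 0) (fun z => l z * pd s (1, 0) f z) (x, t) :=
    arcDeriv_eq hc.smooth hq slf e4
  -- Up to the factor |X|⁻¹ this is (k²)'' = 2h'² + 2hh''.
  have e6 : pd s (1, 0) (fun z => l z * pd s (1, 0) f z) (x, t)
      = 2 * (pd s (1, 0) h (x, t) * (l (x, t) * pd s (1, 0) h (x, t))
        + h (x, t) * pd s (1, 0) (fun z => l z * pd s (1, 0) h z) (x, t)) := by
    rw [← pd_mul hu sh slh hq, pd_congr
      (f' := fun z => (fun _ => (2 : ℝ)) z * (h z * (l z * pd s (1, 0) h z))) _ hq,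
      pd_mul hu contDiffOn_const (sh.mul slh) hq, pd_const]
    · ring
    · intro z hz
      simp only [hfh _ z hz]
      ring
  rw [e4 x hq, hfh _ _ hq] at hle
  rw [e2, e5, e6, hfh _ _ hq] at hev
  rw [e1, e3]
  set N := normSqPerpDerivH T g c x t
  set k := curvature g c x t with hk
  have hk0 : 0 ≤ k := Real.sqrt_nonneg _
  have hsq : h (x, t) ^ 2 = k ^ 2 + ε ^ 2 := regCurvature_sq x t
  have hh0 : 0 < h (x, t) := Real.sqrt_pos.2 (by positivity)
  have hkh : k ≤ h (x, t) := le_of_sq_le_sq (by rw [hsq]; nlinarith [sq_nonneg ε]) hh0.le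
  change _ ≤ _ + _ + K / 2 * (h (x, t) + 1)
  set h0 := h (x, t)
  set ht := pd s (0, 1) h (x, t)
  set hx := pd s (1, 0) h (x, t)
  set l0 := l (x, t)
  set hxx := pd s (1, 0) (fun z => l z * pd s (1, 0) h z) (x, t)
  -- With (k²)' = 2hh' the Kato-type bound reads h²h'² ≤ N k² ≤ N h². Hence 2h'² is absorbed by -2N.
  have hN : (l0 * hx) ^ 2 ≤ N := by
    have h1 : h0 ^ 2 * (l0 * hx) ^ 2 ≤ N * k ^ 2 := by linarith
    have hN0 : 0 ≤ N := normSqPerpDerivH_nonneg hT hg hc ht'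
    have h2 : N * k ^ 2 ≤ N * h0 ^ 2 := by gcongr
    have h3 : h0 ^ 2 * (l0 * hx) ^ 2 ≤ h0 ^ 2 * N := by linarith
    exact le_of_mul_le_mul_left h3 (by positivity)
  have t1 : k ^ 4 ≤ h0 * k ^ 3 := by
    calc k ^ 4 = k * k ^ 3 := by ring
      _ ≤ h0 * k ^ 3 := by gcongr
  have t2 : K * (k ^ 2 + k) ≤ K * (h0 * (h0 + 1)) := by
    refine mul_le_mul_of_nonneg_left ?_ hK
    nlinarith
  -- Both sides are kept multiplied by h > 0, so that k ≤ h replaces the bounds k⁴/h ≤ k³ and (k² +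
  -- k)/h ≤ h + 1.
  have t3 : h0 * ht ≤ h0 * (l0 * hxx + k ^ 3 + K / 2 * (h0 + 1)) := by linarith
  exact le_of_mul_le_mul_left t3 hh0

/-- Every point has a neighbourhood on which the evolution inequality holds with a uniform
constant. -/
theorem exists_nhds_evolution {T : ℝ} (hT : 0 < T) {g : ℝ → SmoothMetric E M}
    (hg : IsRicciFlow T g) (p : M) :
    ∃ N ∈ nhds p, ∃ K : ℝ, 0 ≤ K ∧ ∀ c : Circle → ℝ → M, IsCurveShrinkingFlow T g c →
      ∀ x : ℝ, ∀ t ∈ Icc 0 T, c (Circle.exp x) t ∈ N →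
        derivWithin (fun τ => curvature g c x τ ^ 2) (Icc 0 T) t ≤
          arcDeriv g c (arcDeriv g c (fun ξ τ => curvature g c ξ τ ^ 2)) x t
            - 2 * normSqPerpDerivH T g c x t + 2 * curvature g c x t ^ 4
            + K * (curvature g c x t ^ 2 + curvature g c x t) := by
  have : ProperSpace E := FiniteDimensional.proper ℝ E
  have h1 : chartDomain E p ∈ nhds (extChartAt 𝓘(ℝ, E) p p) :=
    (isOpen_chartDomain p).mem_nhds (mem_extChartAt_target p)
  obtain ⟨r, hr, hrs⟩ := Metric.nhds_basis_closedBall.mem_iff.1 h1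
  -- The constant is fixed before any curve is chosen, so it depends on the ambient flow alone.
  obtain ⟨C, hC⟩ := (isMetricFamily_chartMetric hT hg p).exists_metricBound
    ((isCompact_closedBall (extChartAt 𝓘(ℝ, E) p p) r).prod isCompact_Icc)
    (prod_mono hrs (subset_refl (Icc 0 T)))
  have h0 : 0 ≤ C := (hC (extChartAt 𝓘(ℝ, E) p p, 0)
    ⟨Metric.mem_closedBall_self hr.le, left_mem_Icc.2 hT.le⟩).nonneg
  refine ⟨(chartAt E p).source ∩ extChartAt 𝓘(ℝ, E) p ⁻¹'
    Metric.closedBall (extChartAt 𝓘(ℝ, E) p p) r, ?_, evolutionConst C,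
    evolutionConst_nonneg h0, ?_⟩
  · exact Filter.inter_mem (chart_source_mem_nhds E p)
      ((continuousAt_extChartAt p).preimage_mem_nhds (Metric.closedBall_mem_nhds _ hr))
  · intro c hc x t ht hN
    have hq : (x, t) ∈ curveDomain E T c p := ⟨ht, hN.1⟩
    exact evolution_curvature_sq hT hg hc hq (hC _ ⟨hN.2, ht⟩)

end Evolution

end

/-! ### The global constant by compactness of M -/

theorem mainTheorem4 {E : Type*} [NormedAddCommGroup E] [NormedSpace ℝ E] [FiniteDimensional ℝ E]
    {M : Type*} [TopologicalSpace M] [ChartedSpace E M] [IsManifold 𝓘(ℝ, E) ∞ M]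
    [CompactSpace M] [T2Space M] {T : ℝ} (hT : 0 < T)
    (g : ℝ → SmoothMetric E M) (hg : IsRicciFlow T g) :
    ∃ Chat : ℝ, 0 ≤ Chat ∧
      ∀ c : Circle → ℝ → M, IsCurveShrinkingFlow T g c →
        (ContDiffOn ℝ ∞ (fun q : ℝ × ℝ => curvature g c q.1 q.2 ^ 2) (univ ×ˢ Icc 0 T) ∧
          ∀ x : ℝ, ∀ t ∈ Icc 0 T,
            derivWithin (fun τ => curvature g c x τ ^ 2) (Icc 0 T) t ≤
              arcDeriv g c (arcDeriv g c (fun ξ τ => curvature g c ξ τ ^ 2)) x t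
                - 2 * normSqPerpDerivH T g c x t
                + 2 * curvature g c x t ^ 4
                + Chat * (curvature g c x t ^ 2 + curvature g c x t)) ∧
        ∀ ε : ℝ, 0 < ε →
          ContDiffOn ℝ ∞ (fun q : ℝ × ℝ => regCurvature g c ε q.1 q.2) (univ ×ˢ Icc 0 T) ∧
          ∀ x : ℝ, ∀ t ∈ Icc 0 T,
            derivWithin (fun τ => regCurvature g c ε x τ) (Icc 0 T) t ≤
              arcDeriv g c (arcDeriv g c (regCurvature g c ε)) x t
                + curvature g c x t ^ 3
                + Chat / 2 * (regCurvature g c ε x t + 1) := by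
  choose N hN K hK hev using exists_nhds_evolution (E := E) hT hg
  obtain ⟨F, hF⟩ := isCompact_univ.elim_nhds_subcover N fun p _ => hN p
  -- The sum serves as a common upper bound for the finitely many nonnegative local constants; it
  -- may replace each of them since k² + k ≥ 0.
  have h0 : 0 ≤ ∑ p ∈ F, K p := Finset.sum_nonneg fun p _ => hK p
  have key : ∀ c : Circle → ℝ → M, IsCurveShrinkingFlow T g c → ∀ x : ℝ, ∀ t ∈ Icc 0 T,
      derivWithin (fun τ => curvature g c x τ ^ 2) (Icc 0 T) t ≤
        arcDeriv g c (arcDeriv g c (fun ξ τ => curvature g c ξ τ ^ 2)) x t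
          - 2 * normSqPerpDerivH T g c x t + 2 * curvature g c x t ^ 4
          + (∑ p ∈ F, K p) * (curvature g c x t ^ 2 + curvature g c x t) := by
    intro c hc x t ht
    obtain ⟨p, hpF, hp⟩ := mem_iUnion₂.1 (hF.2 (mem_univ (c (Circle.exp x) t)))
    have h1 := hev p c hc x t ht hp
    have h2 : K p ≤ ∑ p ∈ F, K p := Finset.single_le_sum (fun p _ => hK p) hpF
    have h3 : 0 ≤ curvature g c x t := Real.sqrt_nonneg _
    have h4 := mul_le_mul_of_nonneg_right h2
      (show 0 ≤ curvature g c x t ^ 2 + curvature g c x t by positivity)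
    linarith
  refine ⟨∑ p ∈ F, K p, h0, fun c hc => ⟨⟨contDiffOn_curvature_sq hT hg hc, key c hc⟩,
    fun ε hε => ⟨contDiffOn_regCurvature hT hg hc hε, fun x t ht => ?_⟩⟩⟩
  exact evolution_regCurvature hT hg hc ht h0 (key c hc x t ht) hε
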